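/- Let $d\in\{2,3\}$, let $\Omega\subset\mathbb{R}^d$ be a polyhedral domain (bounded, open, connected, equal to the interior of its closure), let $k\ge 1$ and $l\in\{k-1,k\}$ be integers, and let $\theta_*,l_*>0$. There is a constant $C>0$, depending only on $\Omega,d,k,l,\theta_*,l_*$ (in particular not on the mesh size $h$, on $\nu$, $T$, $f$ or $u_0$), such that the following holds. *Mesh.* Let $\mathcal{T}_h$ be a finite partition of $\Omega$ into open polygons/polyhedra $K$ with set of flat faces $\varepsilon_h$; every face is either contained in $\Omega$ and shared by exactly two elements, or contained in $\partial\Omega$ and a face of exactly one element. Let $h_K$ be the infimum of the diameters of the balls containing $K$. Assume that every $K\in\mathcal{T}_h$ is star-shaped with respect to every point of some ball of radius $\theta_*h_K$ centred in $K$, and that any two distinct vertices of $K$ have distance at least $l_*h_K$. Let $\bm n$ be the unit outward normal on $\partial K$, $\tau|_{\partial K}=h_K^{-1}$, $(\cdot,\cdot)_{\mathcal{T}_h}=\sum_K(\cdot,\cdot)_{L^2(K)}$, $\langle\cdot,\cdot\rangle_{\partial\mathcal{T}_h}=\sum_K\langle\cdot,\cdot\rangle_{L^2(\partial K)}$, with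 corresponding norms $\|\cdot\|_{0,\mathcal{T}_h}$, $\|\cdot\|_{0,\partial\mathcal{T}_h}$. *Spaces.* With $P_m(D)$ the polynomials of degree at most $m$ on $D$, let $\bm Q_h=\{\bm v\in[L^2(\Omega)]^d:\bm v|_K\in[P_{k-1}(K)]^d\ \forall K\in\mathcal{T}_h\}$, $V_h=\{v\in L^2(\Omega):v|_K\in P_k(K)\ \forall K\in\mathcal{T}_h\}$ and $\widehat V_h=\{\widehat v\in L^2(\varepsilon_h):\widehat v|_e\in P_l(e)\ \forall e\in\varepsilon_h,\ \widehat v=0\text{ on }\partial\Omega\}$. Let $\Pi_k^o$ be the $L^2$-projection onto $V_h$, and let $\Pi_l^\partial$ be the $L^2(e)$-projection onto $P_l(e)$ on each face $e$ (applied on $\partial K$ to the trace from $K$). *Forms.* Define $\mathcal{K}_h:V_h\times\widehat V_h\to\bm Q_h$ by $(\mathcal{K}_h(w,\mu),\bm r)_{\mathcal{T}_h}=-(w,\nabla\cdot\bm r)_{\mathcal{T}_h}+\langle\mu,\bm r\cdot\bm n\rangle_{\partial\mathcal{T}_h}$ for all $\bm r\in\bm Q_h$, and, with $\bm b(v)=(v,\dots,v)^T\in\mathbb{R}^d$,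 $$\mathcal{S}_h(u,\widehat u;w,\mu)=\nu\langle\tau(\Pi_l^\partial u-\widehat u),\Pi_l^\partial w-\mu\rangle_{\partial\mathcal{T}_h},$$ $$\mathcal{B}_h(v;u,\widehat u;w,\mu)=-\tfrac13(\bm b(v)u,\nabla w)_{\mathcal{T}_h}+\tfrac13(\bm b(v)\cdot\nabla u,w)_{\mathcal{T}_h}-\tfrac13\langle\bm b(v)\cdot\bm n\,u,\mu\rangle_{\partial\mathcal{T}_h}+\tfrac13\langle\bm b(v)\cdot\bm n\,\widehat u,w\rangle_{\partial\mathcal{T}_h},$$ $$|\|(w,\mu)\||^2=\|\mathcal{K}_h(w,\mu)\|_{0,\mathcal{T}_h}^2+\|\tau^{1/2}(\Pi_l^\partial w-\mu)\|_{0,\partial\mathcal{T}_h}^2 .$$ *Claim.* Let $\nu>0$, $T>0$, $u_0\in L^2(\Omega)$, $f\in L^2(0,T;L^2(\Omega))$, and let $(\bm q_h,u_h,\widehat u_h):[0,T]\to\bm Q_h\times V_h\times\widehat V_h$ be a solution of the semi-discrete HDG scheme for the Burgers equation $u_t-\nu\Delta u+\bm b(u)\cdot\nabla u=f$ with homogeneous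 Dirichlet condition, that is, $u_h$ is absolutely continuous in time, $u_h(0)=\Pi_k^ou_0$, and for almost every $t\in(0,T)$ and all $(w,\mu)\in V_h\times\widehat V_h$ $$\bm q_h+\mathcal{K}_h(u_h,\widehat u_h)=0,$$ $$(u_{h,t},w)_{\mathcal{T}_h}+\nu(\mathcal{K}_h(u_h,\widehat u_h),\mathcal{K}_h(w,\mu))_{\mathcal{T}_h}+\mathcal{S}_h(u_h,\widehat u_h;w,\mu)+\mathcal{B}_h(u_h;u_h,\widehat u_h;w,\mu)=(f,w)_{\mathcal{T}_h}.$$ Then, for every $t\in[0,T]$, the function $s\mapsto|\|(u_h(s),\widehat u_h(s))\||^2$ is integrable on $(0,t)$ and $$\|u_h(t)\|_{0,\mathcal{T}_h}^2+\nu\int_0^t|\|(u_h(s),\widehat u_h(s))\||^2\,ds\le C\Big(\|u_h(0)\|_{0,\mathcal{T}_h}^2+\frac1\nu\int_0^t\|f(s)\|_{0,\mathcal{T}_h}^2\,ds\Big).$$ -/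

import Mathlib

open MeasureTheory

noncomputable section

open Filter Topology
open scoped Classical

namespace HDG

/-! ### Polynomials -/

/-- `ℝ^d` with the Euclidean norm. -/
abbrev Space (d : ℕ) : Type := EuclideanSpace ℝ (Fin d)

/-- `P_m`: real polynomials in `d` variables of total degree at most `m`. -/
abbrev PolySpace (d m : ℕ) : Submodule ℝ (MvPolynomial (Fin d) ℝ) :=
  MvPolynomial.restrictTotalDegree (Fin d) ℝ m

/-- The value `p(x)`. -/
def ev {d : ℕ} (p : MvPolynomial (Fin d) ℝ) (x : Space d) : ℝ :=
  MvPolynomial.eval (fun i => x i) p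

/-- `∫_K p dx`. -/
def cellInt {d : ℕ} (K : Set (Space d)) (p : MvPolynomial (Fin d) ℝ) : ℝ :=
  ∫ x in K, ev p x

/-- `∫_e p ds`, where `ds` is the `(d-1)`-dimensional surface measure (the Hausdorff measure
normalised so that it is Lebesgue measure on hyperplanes). -/
def faceInt {d : ℕ} (e : Set (Space d)) (p : MvPolynomial (Fin d) ℝ) : ℝ :=
  ∫ x in e, ev p x ∂(μHE[d - 1])

/-! ### Polyhedra and meshes -/

/-- A compact polyhedral set: a finite union of convex hulls of finite sets. -/
def IsPolyhedralSet {d : ℕ} (S : Set (Space d)) : Prop :=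
  ∃ F : Finset (Finset (Space d)), S = ⋃ s ∈ F, convexHull ℝ (s : Set (Space d))

/-- An open polygon/polyhedron, not necessarily convex or simply connected. The condition
`interior (closure K) = K` says that `K` has no slits or punctures. -/
structure IsOpenPolyhedron {d : ℕ} (K : Set (Space d)) : Prop where
  isOpen : IsOpen K
  isConnected : IsConnected K
  regular : interior (closure K) = K
  polyhedral : IsPolyhedralSet (closure K)

/-- A flat face (an edge if `d = 2`): a connected subset `e` of a hyperplane with polyhedral
closure which is the interior of its closure relative to the hyperplane. -/
structure IsFlatFace {d : ℕ} (e : Set (Space d)) : Prop where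
  flat : ∃ (n : Space d) (c : ℝ), ‖n‖ = 1 ∧
    e = {x | inner ℝ n x = c ∧ closure e ∈ 𝓝[{y | inner ℝ n y = c}] x}
  isConnected : IsConnected e
  polyhedral : IsPolyhedralSet (closure e)

/-- The vertices of a face `e`: the points of its closure near which the closure is not invariant
under translation in any direction. -/
def faceVertices {d : ℕ} (e : Set (Space d)) : Set (Space d) :=
  {x | x ∈ closure e ∧ ¬ ∃ v : Space d, v ≠ 0 ∧ ∃ r : ℝ, 0 < r ∧
    ∀ y ∈ Metric.ball x r, ∀ s : ℝ, y + s • v ∈ Metric.ball x r →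
      (y ∈ closure e ↔ y + s • v ∈ closure e)}

/-- `h_K`: the infimum of the diameters of the circles (spheres) containing `K`. -/
def cellSize {d : ℕ} (K : Set (Space d)) : ℝ :=
  sInf {δ : ℝ | ∃ c : Space d, K ⊆ Metric.closedBall c (δ / 2)}

/-- A partition of `Ω` into open polygons/polyhedra, together with its faces and the unit
outward normals. The faces of a cell `K` are the faces of the mesh contained in `∂K`. A vertex of
a neighbouring cell in the interior of a side of `K` splits that side into several faces. -/
structure PolyMesh {d : ℕ} (Ω : Set (Space d)) where
  cells : Finset (Set (Space d))
  faces : Finset (Set (Space d))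
  /-- `normal K e` is the unit normal on the face `e` of `K` pointing out of `K`. -/
  normal : Set (Space d) → Set (Space d) → Space d
  cell_polyhedron : ∀ K ∈ cells, IsOpenPolyhedron K
  cell_disjoint : ∀ K ∈ cells, ∀ K' ∈ cells, K ≠ K' → Disjoint K K'
  cell_cover : (⋃ K ∈ cells, closure K) = closure Ω
  face_flat : ∀ e ∈ faces, IsFlatFace e
  face_disjoint : ∀ e ∈ faces, ∀ e' ∈ faces, e ≠ e' → Disjoint e e'
  frontier_cell : ∀ K ∈ cells, frontier K = ⋃ e ∈ {e ∈ faces | e ⊆ frontier K}, closure e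
  /-- An interior face lies in `Ω` and is shared by exactly two cells, a boundary face lies in
  `∂Ω` and belongs to exactly one cell. -/
  face_cells : ∀ e ∈ faces,
    (e ⊆ Ω ∧ {K ∈ cells | e ⊆ frontier K}.card = 2) ∨
    (e ⊆ frontier Ω ∧ {K ∈ cells | e ⊆ frontier K}.card = 1)
  normal_spec : ∀ K ∈ cells, ∀ e ∈ faces, e ⊆ frontier K →
    ‖normal K e‖ = 1 ∧ (∀ x ∈ e, ∀ y ∈ e, inner ℝ (normal K e) (x - y) = 0) ∧
    ∀ x ∈ e, ∀ᶠ s : ℝ in 𝓝[>] 0,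
      x - s • normal K e ∈ K ∧ x + s • normal K e ∉ closure K

/-! ### Well-definedness of the projections and of the discrete gradient -/

theorem continuous_ev {d : ℕ} (p : MvPolynomial (Fin d) ℝ) :
    Continuous (ev p : Space d → ℝ) := by
  unfold ev
  have h := MvPolynomial.continuous_eval p
  exact h.comp (by fun_prop)

theorem IsPolyhedralSet.isCompact {d : ℕ} {S : Set (Space d)} (h : IsPolyhedralSet S) :
    IsCompact S := by
  obtain ⟨F, rfl⟩ := h
  exact F.isCompact_biUnion fun s _ => s.finite_toSet.isCompact_convexHull (𝕜 := ℝ)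

theorem integrable_ev {d : ℕ} {μ : Measure (Space d)} {e : Set (Space d)}
    (he : IsCompact (closure e)) (hμ : μ e < ⊤) (p : MvPolynomial (Fin d) ℝ) :
    IntegrableOn (ev p) e μ := by
  obtain ⟨C, hC⟩ := he.exists_bound_of_continuousOn (continuous_ev p).continuousOn
  refine Measure.integrableOn_of_bounded hμ.ne (continuous_ev p).aestronglyMeasurable (M := C) ?_
  have : ∀ᵐ x ∂(μ.restrict e), x ∈ closure e := by
    have h1 : μ.restrict e ≤ μ.restrict (closure e) :=
      Measure.restrict_mono subset_closure le_rfl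
    exact h1.absolutelyContinuous.ae_le (ae_restrict_mem isClosed_closure.measurableSet)
  filter_upwards [this] with x hx using hC x hx

theorem IsFlatFace.measure_lt_top {d : ℕ} {e : Set (Space d)} (he : IsFlatFace e) :
    (μHE[d - 1] : Measure (Space d)) e < ⊤ := by
  obtain ⟨n, c, hn, hU⟩ := he.flat
  have hn0 : n ≠ 0 := by rintro rfl; simp at hn
  let H : Submodule ℝ (Space d) := (Submodule.span ℝ {n})ᗮ
  let φ : H → Space d := fun v => (v : Space d) + c • n
  have hφ : Isometry φ := fun a b => by simp [φ, Subtype.edist_eq]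
  have hrank : Module.finrank ℝ H = d - 1 := by
    have h1 := Submodule.finrank_add_finrank_orthogonal (Submodule.span ℝ {n})
    rw [finrank_span_singleton hn0, finrank_euclideanSpace_fin] at h1
    change Module.finrank ℝ (Submodule.span ℝ {n})ᗮ = d - 1
    omega
  have hsub : e ⊆ Set.range φ := by
    intro x hx
    rw [hU] at hx
    refine ⟨⟨x - c • n, ?_⟩, by simp [φ]⟩
    rw [Submodule.mem_orthogonal_singleton_iff_inner_right]
    have : inner ℝ n x = c := hx.1
    rw [inner_sub_right, this, inner_smul_right, real_inner_self_eq_norm_sq, hn]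
    simp
  have h2 := hφ.euclideanHausdorffMeasure_preimage (d := d - 1) e
  rw [Set.inter_eq_left.2 hsub] at h2
  rw [← h2, ← hrank]
  have hb : Bornology.IsBounded e := he.polyhedral.isCompact.isBounded.subset subset_closure
  exact (hφ.antilipschitz.isBounded_preimage hb).measure_lt_top

/-- `p ↦ ∫_e p dμ` as a linear functional. -/
def intFunctional {d : ℕ} (μ : Measure (Space d)) (e : Set (Space d))
    (h : ∀ p : MvPolynomial (Fin d) ℝ, IntegrableOn (ev p) e μ) :
    MvPolynomial (Fin d) ℝ →ₗ[ℝ] ℝ where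
  toFun p := ∫ x in e, ev p x ∂μ
  map_add' p q := by
    rw [← integral_add (h p) (h q)]
    simp [ev]
  map_smul' c p := by
    simp [ev, integral_const_mul]

theorem exists_representation {d m : ℕ} (I L : MvPolynomial (Fin d) ℝ →ₗ[ℝ] ℝ)
    (h : ∀ p : MvPolynomial (Fin d) ℝ, I (p * p) = 0 → L p = 0) :
    ∃ p : PolySpace d m, ∀ q : PolySpace d m, I (p * q) = L q := by
  let B : PolySpace d m →ₗ[ℝ] PolySpace d m →ₗ[ℝ] ℝ :=
    ((LinearMap.mul ℝ (MvPolynomial (Fin d) ℝ)).compr₂ I).domRestrict₁₂ _ _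
  have hB : ∀ p q, B p q = I (p * q) := fun p q => rfl
  have hmem : L.domRestrict (PolySpace d m) ∈ (LinearMap.ker B).dualAnnihilator := by
    rw [Submodule.mem_dualAnnihilator]
    intro p hp
    apply h
    have h1 : B p p = 0 := by rw [LinearMap.mem_ker.1 hp]; rfl
    exact h1
  rw [LinearMap.dualAnnihilator_ker_eq_range_flip] at hmem
  obtain ⟨p, hp⟩ := hmem
  refine ⟨p, fun q => ?_⟩
  have := congrArg (fun f => f q) hp
  simp only [LinearMap.flip_apply, hB, LinearMap.domRestrict_apply] at this
  rw [mul_comm, this]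

theorem ae_zero_of_int_sq {d : ℕ} {μ : Measure (Space d)} {e : Set (Space d)}
    (h : ∀ p : MvPolynomial (Fin d) ℝ, IntegrableOn (ev p) e μ) {p : MvPolynomial (Fin d) ℝ}
    (hp : ∫ x in e, ev (p * p) x ∂μ = 0) : ∀ᵐ x ∂(μ.restrict e), ev p x = 0 := by
  have h0 : 0 ≤ᵐ[μ.restrict e] ev (p * p) :=
    Eventually.of_forall fun x => by simp [ev, mul_self_nonneg]
  have := (integral_eq_zero_iff_of_nonneg_ae h0 (h _)).1 hp
  filter_upwards [this] with x hx
  simpa [ev] using hx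

theorem eq_zero_of_cellInt_sq {d : ℕ} {K : Set (Space d)} (hK : IsOpenPolyhedron K)
    {p : MvPolynomial (Fin d) ℝ} (hp : cellInt K (p * p) = 0) : p = 0 := by
  have hc := hK.polyhedral.isCompact
  have hfin : (volume : Measure (Space d)) K < ⊤ :=
    (measure_mono subset_closure).trans_lt hc.measure_lt_top
  have hae := ae_zero_of_int_sq (integrable_ev hc hfin) hp
  have hz : ∀ x ∈ K, ev p x = 0 := by
    have := Measure.eqOn_open_of_ae_eq (f := ev p) (g := fun _ => (0 : ℝ)) hae hK.isOpen
      (continuous_ev p).continuousOn continuousOn_const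
    exact this
  obtain ⟨x, hx⟩ := hK.isConnected.nonempty
  have hpre : IsOpen ((WithLp.toLp 2 : (Fin d → ℝ) → Space d) ⁻¹' K) :=
    hK.isOpen.preimage (by fun_prop)
  obtain ⟨r, hr, hball⟩ := Metric.isOpen_iff.1 hpre (WithLp.ofLp x) (by simpa using hx)
  refine MvPolynomial.funext_set (fun i => Metric.ball (x i) r) (fun i => ?_) fun y hy => ?_
  · rw [Real.ball_eq_Ioo]
    exact Set.Ioo_infinite (by linarith)
  · rw [← ball_pi _ hr] at hy
    have := hz _ (hball hy)
    simpa [ev] using this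

theorem exists_faceProj {d l : ℕ} {e : Set (Space d)} (he : IsFlatFace e)
    (w : MvPolynomial (Fin d) ℝ) :
    ∃ p : PolySpace d l, ∀ q : PolySpace d l, faceInt e (p * q) = faceInt e (w * q) := by
  have hint := integrable_ev he.polyhedral.isCompact he.measure_lt_top
  refine exists_representation (intFunctional _ e hint)
    ((intFunctional _ e hint).comp (LinearMap.mulLeft ℝ w)) fun p hp => ?_
  have := ae_zero_of_int_sq hint hp
  refine integral_eq_zero_of_ae ?_
  filter_upwards [this] with x hx
  have hx' : (MvPolynomial.eval fun i => x i) p = 0 := hx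
  simp [ev, hx']

/-! ### Finite element spaces and mesh-dependent forms -/

namespace PolyMesh

variable {d : ℕ} {Ω : Set (Space d)} (M : PolyMesh Ω)

/-- The faces making up `∂K`. -/
def facesOf (K : M.cells) : Finset M.faces :=
  Finset.univ.filter fun e => (e : Set (Space d)) ⊆ frontier (K : Set (Space d))

/-- Shape regularity: (i) every cell `K` is star-shaped with respect to every point of a ball of
radius `θ h_K` centred in `K`; (ii) distinct vertices of `K` have distance at least `ℓ h_K`. -/
structure ShapeRegular (θ ℓ : ℝ) : Prop where
  star : ∀ K ∈ M.cells, ∃ c ∈ K, ∀ y ∈ Metric.ball c (θ * cellSize K), StarConvex ℝ y K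
  vertices : ∀ K ∈ M.cells, ∀ x y : Space d,
    (∃ e ∈ M.faces, e ⊆ frontier K ∧ x ∈ faceVertices e) →
    (∃ e ∈ M.faces, e ⊆ frontier K ∧ y ∈ faceVertices e) →
    x ≠ y → ℓ * cellSize K ≤ dist x y

/-- `V_h`: piecewise polynomials of degree at most `k`; `v K` is the polynomial `v|_K`, whose
restriction to `∂K` is the trace from `K`. -/
abbrev V (k : ℕ) : Type := M.cells → PolySpace d k

/-- `Q_h`: piecewise polynomial vector fields of degree at most `k - 1`. -/
abbrev Q (k : ℕ) : Type := M.cells → Fin d → PolySpace d (k - 1)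

/-- `V̂_h`: polynomials of degree at most `l` on every face, vanishing on the faces in `∂Ω`.
A polynomial on a face `e` is given by a polynomial on `ℝ^d`; only its values on `e` matter. -/
def Vhat (l : ℕ) : Submodule ℝ (M.faces → PolySpace d l) where
  carrier := {μ | ∀ e : M.faces, (e : Set (Space d)) ⊆ frontier Ω →
    ∀ x ∈ (e : Set (Space d)), ev (μ e : MvPolynomial (Fin d) ℝ) x = 0}
  zero_mem' := by intro e _ x _; simp [ev]
  add_mem' := by
    intro a b ha hb e he x hx
    have h1 := ha e he x hx
    have h2 := hb e he x hx
    simp only [ev] at h1 h2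
    simp [ev, h1, h2]
  smul_mem' := by
    intro c a ha e he x hx
    have h1 := ha e he x hx
    simp only [ev] at h1
    simp [ev, h1]

/-- The `L²(e)`-projection of (the restriction to `e` of) `w` onto the polynomials of degree at
most `l` on `e`. It is determined on `e` by its defining property `faceProj_spec`. -/
def faceProj (l : ℕ) (e : M.faces) (w : MvPolynomial (Fin d) ℝ) : PolySpace d l :=
  Classical.choose (exists_faceProj (l := l) (M.face_flat e e.2) w)

theorem faceProj_spec (l : ℕ) (e : M.faces) (w : MvPolynomial (Fin d) ℝ) (q : PolySpace d l) :
    faceInt (e : Set (Space d)) ((M.faceProj l e w).1 * q.1) = faceInt (e : Set (Space d)) (w * q.1) :=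
  Classical.choose_spec (exists_faceProj (l := l) (M.face_flat e e.2) w) q

/-- `(u, v)_{T_h}` on `V_h`. -/
def innerV {k : ℕ} (u v : M.V k) : ℝ := ∑ K : M.cells, cellInt K.1 ((u K).1 * (v K).1)

/-- `(p, r)_{T_h}` on `Q_h`. -/
def innerQ {k : ℕ} (p r : M.Q k) : ℝ :=
  ∑ K : M.cells, ∑ i, cellInt K.1 ((p K i).1 * (r K i).1)

/-- `(f, w)_{T_h}` for `f ∈ L²(Ω)`. -/
def load {k : ℕ} (f : Lp ℝ 2 ((volume : Measure (Space d)).restrict Ω)) (w : M.V k) : ℝ :=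
  ∑ K : M.cells, ∫ x in (K : Set (Space d)), f x * ev (w K : MvPolynomial (Fin d) ℝ) x

/-- `‖f‖²_{0,T_h}` for `f ∈ L²(Ω)`. -/
def loadNormSq (f : Lp ℝ 2 ((volume : Measure (Space d)).restrict Ω)) : ℝ :=
  ∑ K : M.cells, ∫ x in (K : Set (Space d)), f x ^ 2

theorem exists_discreteGrad {k l : ℕ} (w : M.V k) (μ : M.Vhat l) :
    ∃ κ : M.Q k, ∀ r : M.Q k, M.innerQ κ r =
      -(∑ K : M.cells, cellInt K.1 ((w K).1 * ∑ i, MvPolynomial.pderiv i (r K i).1)) +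
      ∑ K : M.cells, ∑ e ∈ M.facesOf K,
        faceInt e.1 ((μ.1 e).1 * ∑ i, MvPolynomial.C (M.normal K e i) * (r K i).1) := by
  have hcell : ∀ (K : M.cells) (p : MvPolynomial (Fin d) ℝ),
      IntegrableOn (ev p) (K : Set (Space d)) volume := fun K =>
    have hc := (M.cell_polyhedron K K.2).polyhedral.isCompact
    integrable_ev hc ((measure_mono subset_closure).trans_lt hc.measure_lt_top)
  have hface : ∀ (e : M.faces) (p : MvPolynomial (Fin d) ℝ),
      IntegrableOn (ev p) (e : Set (Space d)) (μHE[d - 1]) := fun e =>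
    integrable_ev (M.face_flat e e.2).polyhedral.isCompact (M.face_flat e e.2).measure_lt_top
  let IK := fun K : M.cells => intFunctional _ _ (hcell K)
  let Ie := fun e : M.faces => intFunctional _ _ (hface e)
  have hIK : ∀ (K : M.cells) p, cellInt K.1 p = IK K p := fun _ _ => rfl
  have hIe : ∀ (e : M.faces) p, faceInt e.1 p = Ie e p := fun _ _ => rfl
  let L : M.cells → Fin d → MvPolynomial (Fin d) ℝ →ₗ[ℝ] ℝ := fun K i =>
    -((IK K).comp ((LinearMap.mulLeft ℝ (w K : MvPolynomial (Fin d) ℝ)).comp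
      (MvPolynomial.pderiv i).toLinearMap)) +
    ∑ e ∈ M.facesOf K, (Ie e).comp ((LinearMap.mulLeft ℝ (μ.1 e : MvPolynomial (Fin d) ℝ)).comp
      (LinearMap.mulLeft ℝ (MvPolynomial.C (M.normal K e i))))
  have hex : ∀ K i, ∃ p : PolySpace d (k - 1), ∀ q : PolySpace d (k - 1),
      IK K (p * q) = L K i q := fun K i =>
    exists_representation (IK K) (L K i) fun p hp => by
      have h0 : p = 0 := eq_zero_of_cellInt_sq (M.cell_polyhedron K K.2) ((hIK K _).trans hp)
      rw [h0, map_zero]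
  choose κ hκ using hex
  refine ⟨κ, fun r => ?_⟩
  simp only [innerQ, hIK, hIe, hκ, Finset.mul_sum, map_sum]
  rw [← Finset.sum_neg_distrib, ← Finset.sum_add_distrib]
  refine Finset.sum_congr rfl fun K _ => ?_
  rw [Finset.sum_comm (s := M.facesOf K), ← Finset.sum_neg_distrib, ← Finset.sum_add_distrib]
  refine Finset.sum_congr rfl fun i _ => ?_
  simp [L]

/-- The discrete gradient `𝒦_h(w, μ) ∈ Q_h`, defined by
`(𝒦_h(w, μ), r)_{T_h} = -(w, ∇·r)_{T_h} + ⟨μ, r·n⟩_{∂T_h}` for all `r ∈ Q_h`. -/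
def discreteGrad {k l : ℕ} (w : M.V k) (μ : M.Vhat l) : M.Q k :=
  Classical.choose (M.exists_discreteGrad w μ)

theorem discreteGrad_spec {k l : ℕ} (w : M.V k) (μ : M.Vhat l) (r : M.Q k) :
    M.innerQ (M.discreteGrad w μ) r =
      -(∑ K : M.cells, cellInt K.1 ((w K).1 * ∑ i, MvPolynomial.pderiv i (r K i).1)) +
      ∑ K : M.cells, ∑ e ∈ M.facesOf K,
        faceInt e.1 ((μ.1 e).1 * ∑ i, MvPolynomial.C (M.normal K e i) * (r K i).1) :=
  Classical.choose_spec (M.exists_discreteGrad w μ) r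

/-- `⟨τ (Π u - û), Π w - μ⟩_{∂T_h}` with `τ = h_K⁻¹` on `∂K` and `Π` the face projection. -/
def jump {k l : ℕ} (u : M.V k) (û : M.Vhat l) (w : M.V k) (μ : M.Vhat l) : ℝ :=
  ∑ K : M.cells, ∑ e ∈ M.facesOf K, (cellSize K.1)⁻¹ *
    faceInt e.1 (((M.faceProj l e (u K).1).1 - (û.1 e).1) *
      ((M.faceProj l e (w K).1).1 - (μ.1 e).1))

/-- The stabilisation `𝒮_h(u, û; w, μ)`. -/
def stab (ν : ℝ) {k l : ℕ} (u : M.V k) (û : M.Vhat l) (w : M.V k) (μ : M.Vhat l) : ℝ :=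
  ν * M.jump u û w μ

/-- The convection form `ℬ_h(v; u, û; w, μ)`, with `b(v) = (v, …, v)`. -/
def conv {k l : ℕ} (v u : M.V k) (û : M.Vhat l) (w : M.V k) (μ : M.Vhat l) : ℝ :=
  -(1 / 3) * (∑ K : M.cells, ∑ i,
      cellInt K.1 ((v K).1 * (u K).1 * MvPolynomial.pderiv i (w K).1))
  + (1 / 3) * (∑ K : M.cells, ∑ i,
      cellInt K.1 ((v K).1 * MvPolynomial.pderiv i (u K).1 * (w K).1))
  - (1 / 3) * (∑ K : M.cells, ∑ e ∈ M.facesOf K,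
      (∑ i, M.normal K e i) * faceInt e.1 ((v K).1 * (u K).1 * (μ.1 e).1))
  + (1 / 3) * (∑ K : M.cells, ∑ e ∈ M.facesOf K,
      (∑ i, M.normal K e i) * faceInt e.1 ((v K).1 * (û.1 e).1 * (w K).1))

/-- The squared energy norm `|||(w, μ)|||²`. -/
def energySq {k l : ℕ} (w : M.V k) (μ : M.Vhat l) : ℝ :=
  M.innerQ (M.discreteGrad w μ) (M.discreteGrad w μ) + M.jump w μ w μ

/-- `(q, u, û)` solves the semi-discrete HDG scheme on `[0, T]` with viscosity `ν`, force
`f` and initial datum `u₀`: `u` is absolutely continuous in time, the scheme holds for almost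
every time, and `u(0)` is the `L²`-projection of `u₀` to `V_h`. -/
structure IsSemiDiscreteSolution {k l : ℕ} (ν T : ℝ)
    (f : ℝ → Lp ℝ 2 ((volume : Measure (Space d)).restrict Ω))
    (u₀ : Lp ℝ 2 ((volume : Measure (Space d)).restrict Ω))
    (q : ℝ → M.Q k) (u : ℝ → M.V k) (û : ℝ → M.Vhat l) : Prop where
  absCont : ∀ (K : M.cells) (x : Space d),
    AbsolutelyContinuousOnInterval (fun t => ev (u t K).1 x) 0 T
  scheme : ∀ᵐ t ∂((volume : Measure ℝ).restrict (Set.Ioo 0 T)),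
    q t + M.discreteGrad (u t) (û t) = 0 ∧
    ∃ ut : M.V k,
      (∀ (K : M.cells) (x : Space d), HasDerivAt (fun s => ev (u s K).1 x) (ev (ut K).1 x) t) ∧
      ∀ (w : M.V k) (μ : M.Vhat l),
        M.innerV ut w + ν * M.innerQ (M.discreteGrad (u t) (û t)) (M.discreteGrad w μ)
          + M.stab ν (u t) (û t) w μ + M.conv (u t) (u t) (û t) w μ = M.load (f t) w
  initial : ∀ w : M.V k, M.innerV (u 0) w = M.load u₀ w

end PolyMesh

end HDG

end

open MeasureTheory

noncomputable section

open Filter Topology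
open scoped Classical

namespace HDG

variable {d : ℕ}

/-! Testing the scheme with `(w, μ) = (u_h, û_h)` makes the convection form vanish identically
(`conv_self`): for `v = u = w` and `μ = û` its two cell terms cancel, and so do its two face terms.
What remains is the energy identity `½ d/dt ‖u_h‖² + ν |||(u_h, û_h)|||² = (f, u_h)` for almost
every time. The load is absorbed with the discrete Poincaré inequality `‖w‖² ≤ C |||(w, μ)|||²`
(`exists_discrete_poincare`), and integration in time gives the estimate
(`IsSemiDiscreteSolution.stability`). All dependence on the mesh sits in this Poincaré inequality,
whose constant must come from `Ω`, `d`, `k` and `θ` alone.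

It rests on three estimates. (a) Integrating `∂_i (x_i w²)` over each cell, and subtracting the face
integrals of `n_i x_i μ²`, whose total over the mesh is zero because normals cancel on interior
faces and `μ = 0` on the boundary, bounds `‖w‖²` by `Σ ‖∇w‖²_K + Σ h_K⁻¹ ‖w - μ‖²_∂K`
(`innerV_self_le`). (b) Testing the discrete gradient with `∇w` bounds `Σ ‖∇w‖²_K` by the energy;
the face projection enters because `∂_n w` has degree `k - 1 ≤ l` (`sum_gradSq_le`). (c) The part `w
- Πw` of `w - μ` is at most `w` minus a constant, hence is controlled by the gradient
(`sum_traceJump_le`).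

The divergence theorem on a cell comes from star-shapedness. Up to a null set the cell is the
disjoint union of the cones from a star centre over its faces. On each cone the field `(x - c) p`
can be integrated by Fubini, and comparing two apexes isolates a single partial derivative
(`cellInt_pderiv`). Inverse and Poincaré inequalities need no reference element: the cell lies
between two concentric balls of comparable radii, so after rescaling they reduce to equivalence of
quadratic forms on a finite-dimensional polynomial space. The inverse inequality and the cone
identity yield the trace inequality. -/

/-! ### Integration over cones -/

/-- Coordinates adapted to a hyperplane with unit normal `n`. -/
def planeParam (c n : Space d) (q : ℝ × (Submodule.span ℝ {n})ᗮ) : Space d :=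
  c + q.1 • n + (q.2 : Space d)

theorem measurePreserving_planeParam (c : Space d) {n : Space d} (hn : ‖n‖ = 1) :
    MeasurePreserving (planeParam c n) (volume.prod volume) volume := by
  have h1 := ((Submodule.span ℝ {n}).measurePreserving_measurableEquivProd c).symm
  rw [InnerProductSpace.euclideanHausdorffMeasure_eq_volume] at h1
  have h2 := (LinearIsometryEquiv.toSpanUnitSingleton n hn).measurePreserving.prod
    (MeasurePreserving.id (volume : Measure (Submodule.span ℝ {n})ᗮ))
  convert! h1.comp h2 using 1
  ext q : 1
  simp [planeParam, add_comm, add_left_comm]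

theorem measurableEmbedding_planeParam (c : Space d) {n : Space d} (hn : ‖n‖ = 1) :
    MeasurableEmbedding (planeParam c n) := by
  have h1 := ((Submodule.span ℝ {n}).measurableEquivProd c).symm.measurableEmbedding
  have h2 := ((LinearIsometryEquiv.toSpanUnitSingleton n hn).toMeasurableEquiv.prodCongr
    (MeasurableEquiv.refl (Submodule.span ℝ {n})ᗮ)).measurableEmbedding
  convert! h1.comp h2 using 1
  ext q : 1
  have hq : (LinearIsometryEquiv.toSpanUnitSingleton n hn).toMeasurableEquiv.prodCongr
    (MeasurableEquiv.refl (Submodule.span ℝ {n})ᗮ) q =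
      (LinearIsometryEquiv.toSpanUnitSingleton n hn q.1, q.2) := rfl
  simp [hq, planeParam, add_comm, add_left_comm]

theorem inner_orthogonal {n : Space d} (v : (Submodule.span ℝ {n})ᗮ) :
    inner ℝ n (v : Space d) = 0 :=
  Submodule.mem_orthogonal_singleton_iff_inner_right.1 v.2

theorem inner_planeParam (c : Space d) {n : Space d} (hn : ‖n‖ = 1)
    (q : ℝ × (Submodule.span ℝ {n})ᗮ) : inner ℝ n (planeParam c n q - c) = q.1 := by
  have : planeParam c n q - c = q.1 • n + q.2 := by simp [planeParam]; abel
  rw [this, inner_add_right, inner_smul_right, inner_orthogonal, real_inner_self_eq_norm_sq, hn]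
  simp

theorem exists_planeParam (c : Space d) {n x : Space d} (hn : ‖n‖ = 1) {δ : ℝ}
    (hx : inner ℝ n (x - c) = δ) : ∃ v, planeParam c n (δ, v) = x := by
  refine ⟨⟨x - c - δ • n, ?_⟩, ?_⟩
  · rw [Submodule.mem_orthogonal_singleton_iff_inner_right, inner_sub_right, hx, inner_smul_right,
      real_inner_self_eq_norm_sq, hn]
    simp
  · simp [planeParam]

theorem isometry_planeParam (c n : Space d) (δ : ℝ) :
    Isometry fun v : (Submodule.span ℝ {n})ᗮ => planeParam c n (δ, v) :=
  fun a b => by simp [planeParam, Subtype.edist_eq]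

theorem finrank_orthogonal_normal {n : Space d} (hn : ‖n‖ = 1) :
    Module.finrank ℝ (Submodule.span ℝ {n})ᗮ = d - 1 := by
  have hn0 : n ≠ 0 := by rintro rfl; simp at hn
  have h1 := Submodule.finrank_add_finrank_orthogonal (Submodule.span ℝ {n})
  rw [finrank_span_singleton hn0, finrank_euclideanSpace_fin] at h1
  omega

theorem dim_pos {n : Space d} (hn : ‖n‖ = 1) : 0 < d := by
  rcases Nat.eq_zero_or_pos d with rfl | h
  · simp [Subsingleton.elim n 0] at hn
  · exact h

/-- The normalised Hausdorff measure is transported by isometries and equals Lebesgue measure on the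
`(d - 1)`-dimensional space `n^⊥`, so face integrals become integrals over `n^⊥`. -/
theorem restrict_surface_eq_map (c : Space d) {n : Space d} (hn : ‖n‖ = 1) {δ : ℝ}
    {e : Set (Space d)} (he : ∀ x ∈ e, inner ℝ n (x - c) = δ) :
    (μHE[d - 1] : Measure (Space d)).restrict e =
      (Measure.map (fun v : (Submodule.span ℝ {n})ᗮ => planeParam c n (δ, v)) volume).restrict e := by
  rw [← InnerProductSpace.euclideanHausdorffMeasure_eq_volume, finrank_orthogonal_normal hn,
    (isometry_planeParam c n δ).map_euclideanHausdorffMeasure, Measure.restrict_restrict_of_subset]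
  exact fun x hx => exists_planeParam c hn (he x hx)

theorem faceInt_eq (c : Space d) {n : Space d} (hn : ‖n‖ = 1) {δ : ℝ}
    {e : Set (Space d)} (he : ∀ x ∈ e, inner ℝ n (x - c) = δ) (p : MvPolynomial (Fin d) ℝ) :
    faceInt e p = ∫ v in {v | planeParam c n (δ, v) ∈ e}, ev p (planeParam c n (δ, v)) := by
  unfold faceInt
  rw [restrict_surface_eq_map c hn he,
    ((isometry_planeParam c n δ).isClosedEmbedding.measurableEmbedding).setIntegral_map]
  rfl

/-- The cone with apex `c` over a subset `e` of the hyperplane `n · (x - c) = δ`. -/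
def cone (c n : Space d) (δ : ℝ) (e : Set (Space d)) : Set (Space d) :=
  {y | inner ℝ n (y - c) ∈ Set.Ioo 0 δ ∧ c + (δ / inner ℝ n (y - c)) • (y - c) ∈ e}

theorem measurableSet_cone (c n : Space d) (δ : ℝ) {e : Set (Space d)} (he : MeasurableSet e) :
    MeasurableSet (cone c n δ e) := by
  have h1 : Measurable fun y : Space d => (inner ℝ n (y - c) : ℝ) := by fun_prop
  have h2 : Measurable fun y : Space d => c + (δ / inner ℝ n (y - c)) • (y - c) := by fun_prop
  exact (h1 measurableSet_Ioo).inter (h2 he)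

theorem mem_cone_iff {c n : Space d} {δ : ℝ} {e : Set (Space d)}
    (he : ∀ x ∈ e, inner ℝ n (x - c) = δ) (hδ : 0 < δ) {y : Space d} :
    y ∈ cone c n δ e ↔ ∃ s ∈ Set.Ioo (0 : ℝ) 1, ∃ x ∈ e, y = c + s • (x - c) := by
  constructor
  · rintro ⟨⟨h0, h1⟩, h2⟩
    refine ⟨inner ℝ n (y - c) / δ, ⟨by positivity, by rwa [div_lt_one hδ]⟩, _, h2, ?_⟩
    rw [add_sub_cancel_left, smul_smul]
    have : inner ℝ n (y - c) / δ * (δ / inner ℝ n (y - c)) = 1 := by field_simp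
    rw [this]; simp
  · rintro ⟨s, ⟨hs0, hs1⟩, x, hx, rfl⟩
    simp only [cone, Set.mem_ofPred_eq, add_sub_cancel_left, inner_smul_right, he x hx]
    refine ⟨⟨by positivity, by nlinarith⟩, ?_⟩
    rw [smul_smul]
    have : δ / (s * δ) * s = 1 := by field_simp
    rw [this]; simpa using hx

/-- The polynomial `d p + (x - c) · ∇p`, the divergence of `(x - c) p`. -/
def radialDiv (c : Space d) (p : MvPolynomial (Fin d) ℝ) : MvPolynomial (Fin d) ℝ :=
  MvPolynomial.C (d : ℝ) * p +
    ∑ i, (MvPolynomial.X i - MvPolynomial.C (c i)) * MvPolynomial.pderiv i p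

theorem hasDerivAt_ev_line (p : MvPolynomial (Fin d) ℝ) (c v : Space d) (s : ℝ) :
    HasDerivAt (fun s : ℝ => ev p (c + s • v))
      (∑ i, v i * ev (MvPolynomial.pderiv i p) (c + s • v)) s := by
  induction p using MvPolynomial.induction_on with
  | C a => simpa [ev] using hasDerivAt_const s a
  | add p q hp hq =>
    convert! hp.add hq using 1
    · ext s; simp [ev]
    · simp [ev, mul_add, Finset.sum_add_distrib]
  | mul_X p j hp =>
    have h1 : HasDerivAt (fun s : ℝ => (c + s • v) j) (v j) s := by
      simpa using ((hasDerivAt_id s).mul_const (v j)).const_add (c j)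
    convert! hp.mul h1 using 1
    · ext s; simp [ev]
    · simp only [ev, MvPolynomial.pderiv_mul, MvPolynomial.pderiv_X, map_add, map_mul,
        MvPolynomial.eval_X, mul_add, Finset.sum_add_distrib, Finset.sum_mul]
      congr 1
      · exact Finset.sum_congr rfl fun i _ => by ring
      · rw [Finset.sum_eq_single j]
        · simp; ring
        · intro i _ hij; simp [hij.symm]
        · simp

/-- The integrand is the derivative of `δ (t/δ)^d p(c + (t/δ) v)`. The weight `(t/δ)^(d-1)` is the
Jacobian of the slices of a cone, and `d > 0` makes the primitive vanish at the apex. -/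
theorem integral_line_radialDiv (hd : 0 < d) {δ : ℝ} (hδ : 0 < δ) (c v : Space d)
    (p : MvPolynomial (Fin d) ℝ) :
    ∫ t in Set.Ioo 0 δ, (t / δ) ^ (d - 1) * ev (radialDiv c p) (c + (t / δ) • v) =
      δ * ev p (c + v) := by
  rw [← integral_Ioc_eq_integral_Ioo, ← intervalIntegral.integral_of_le hδ.le]
  have hderiv : ∀ t ∈ Set.uIcc 0 δ, HasDerivAt
      (fun t => δ * ((t / δ) ^ d * ev p (c + (t / δ) • v)))
      ((t / δ) ^ (d - 1) * ev (radialDiv c p) (c + (t / δ) • v)) t := by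
    intro t _
    have h0 : HasDerivAt (fun t : ℝ => t / δ) (1 / δ) t := (hasDerivAt_id t).div_const δ
    have h1 := (hasDerivAt_ev_line p c v (t / δ)).comp t h0
    have h2 := ((h0.pow d).mul h1).const_mul δ
    convert! h2 using 1
    have hp : (t / δ) ^ d = (t / δ) ^ (d - 1) * (t / δ) := by
      rw [← pow_succ, Nat.sub_add_cancel hd]
    simp only [radialDiv, ev, map_add, map_mul, map_sum, map_sub, MvPolynomial.eval_C,
      MvPolynomial.eval_X, Function.comp_apply]
    have h3 : ∀ i, (c + (t / δ) • v) i - c i = (t / δ) * v i := fun i => by simp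
    simp only [h3, mul_assoc, ← Finset.mul_sum]
    simp only [Pi.pow_apply, hp]
    field_simp
  have hcont : Continuous fun t : ℝ =>
      (t / δ) ^ (d - 1) * ev (radialDiv c p) (c + (t / δ) • v) := by
    have := (continuous_ev (radialDiv c p))
    fun_prop
  rw [intervalIntegral.integral_eq_sub_of_hasDerivAt hderiv (hcont.intervalIntegrable _ _)]
  simp [hδ.ne', hd.ne']

open scoped Pointwise in
-- The divergence theorem for `(x - c) p` on a cone: this field is tangent to the lateral surface,
-- so only the base contributes, with constant flux factor `δ`. The proof is Fubini in height and
-- slice, with each slice rescaled to the base and the height integrated first.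
theorem integral_cone {c n : Space d} (hn : ‖n‖ = 1) {δ : ℝ} (hδ : 0 < δ) {e : Set (Space d)}
    (hem : MeasurableSet e) (heb : Bornology.IsBounded e) (he : ∀ x ∈ e, inner ℝ n (x - c) = δ)
    (p : MvPolynomial (Fin d) ℝ) :
    ∫ y in cone c n δ e, ev (radialDiv c p) y = δ * faceInt e p := by
  have hd : 0 < d := dim_pos hn
  set g := ev (radialDiv c p) with hg
  have hgc : Continuous g := continuous_ev _
  set A : Set (Submodule.span ℝ {n})ᗮ := {v | planeParam c n (δ, v) ∈ e} with hA
  have hAm : MeasurableSet A :=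
    (isometry_planeParam c n δ).continuous.measurable hem
  have hAb : Bornology.IsBounded A :=
    (isometry_planeParam c n δ).antilipschitz.isBounded_preimage heb
  obtain ⟨R, hR⟩ := hAb.subset_closedBall 0
  have hmemc : ∀ t v, planeParam c n (t, v) ∈ cone c n δ e ↔
      t ∈ Set.Ioo 0 δ ∧ (δ / t) • v ∈ A := by
    intro t v
    simp only [cone, Set.mem_ofPred_eq, inner_planeParam c hn, hA]
    refine and_congr_right fun ht => ?_
    have : c + (δ / t) • (planeParam c n (t, v) - c) = planeParam c n (δ, (δ / t) • v) := by
      have ht0 : t ≠ 0 := ht.1.ne'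
      have h1 : planeParam c n (t, v) - c = t • n + v := by simp [planeParam]; abel
      rw [h1, smul_add, smul_smul, div_mul_cancel₀ _ ht0]
      simp [planeParam, add_assoc]
    rw [this]
  have hslice : ∀ t ∈ Set.Ioo 0 δ, {v | planeParam c n (t, v) ∈ cone c n δ e} = (t / δ) • A := by
    intro t ht
    ext v
    rw [Set.mem_ofPred_eq, hmemc, Set.mem_smul_set_iff_inv_smul_mem₀ (div_pos ht.1 hδ).ne', inv_div]
    simp [ht.1, ht.2]
  have hcont2 : Continuous fun q : ℝ × (Submodule.span ℝ {n})ᗮ => planeParam c n q := by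
    unfold planeParam; fun_prop
  rw [← (measurePreserving_planeParam c hn).setIntegral_preimage_emb
    (measurableEmbedding_planeParam c hn), ← integral_indicator
    ((measurePreserving_planeParam c hn).measurable (measurableSet_cone c n δ hem))]
  have hsub : planeParam c n ⁻¹' cone c n δ e ⊆ Set.Icc 0 δ ×ˢ Metric.closedBall 0 R := by
    rintro ⟨t, v⟩ hq
    obtain ⟨ht, hv⟩ := (hmemc t v).1 hq
    refine ⟨⟨ht.1.le, ht.2.le⟩, ?_⟩
    have h1 := hR hv
    rw [mem_closedBall_zero_iff, norm_smul, Real.norm_of_nonneg (div_pos hδ ht.1).le] at h1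
    have h2 : 1 ≤ δ / t := (one_le_div ht.1).2 ht.2.le
    rw [mem_closedBall_zero_iff]
    nlinarith [norm_nonneg v]
  have hint : Integrable ((planeParam c n ⁻¹' cone c n δ e).indicator
      fun q => g (planeParam c n q)) (volume.prod volume) := by
    rw [integrable_indicator_iff
      ((measurePreserving_planeParam c hn).measurable (measurableSet_cone c n δ hem))]
    exact ((hgc.comp hcont2).continuousOn.integrableOn_compact
      (isCompact_Icc.prod (isCompact_closedBall 0 R))).mono_set hsub
  rw [integral_prod _ hint]
  have hinner : ∀ t, ∫ v, (planeParam c n ⁻¹' cone c n δ e).indicator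
      (fun q => g (planeParam c n q)) (t, v) =
      (Set.Ioo 0 δ).indicator (fun t => ∫ v in A,
        (t / δ) ^ (d - 1) * g (c + (t / δ) • (δ • n + (v : Space d)))) t := by
    intro t
    by_cases ht : t ∈ Set.Ioo 0 δ
    · rw [Set.indicator_of_mem ht]
      have h1 : (fun v => (planeParam c n ⁻¹' cone c n δ e).indicator
          (fun q => g (planeParam c n q)) (t, v)) =
          ((t / δ) • A).indicator fun v => g (planeParam c n (t, v)) := by
        ext v
        rw [← hslice t ht]
        simp [Set.indicator_apply]
      rw [h1, integral_indicator (hAm.const_smul₀ _), integral_const_mul]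
      have h2 := Measure.setIntegral_comp_smul_of_pos volume
        (fun v => g (planeParam c n (t, v))) A (div_pos ht.1 hδ)
      rw [finrank_orthogonal_normal hn, smul_eq_mul] at h2
      have h3 : ∀ v : (Submodule.span ℝ {n})ᗮ, planeParam c n (t, (t / δ) • v) =
          c + (t / δ) • (δ • n + (v : Space d)) := fun v => by
        rw [smul_add, smul_smul, div_mul_cancel₀ _ hδ.ne']
        simp [planeParam, add_assoc]
      simp only [h3] at h2
      rw [h2, mul_inv_cancel_left₀ (pow_pos (div_pos ht.1 hδ) _).ne']
    · rw [Set.indicator_of_notMem ht]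
      refine integral_eq_zero_of_ae (Eventually.of_forall fun v => ?_)
      refine Set.indicator_of_notMem ?_ _
      exact fun h => ht ((hmemc t v).1 h).1
  simp only [hinner]
  rw [integral_indicator measurableSet_Ioo, integral_integral_swap]
  · simp only [hg, integral_line_radialDiv hd hδ]
    rw [integral_const_mul, faceInt_eq c hn he]
    simp only [hA, planeParam, add_assoc]
  · have hAc : Continuous fun q : ℝ × (Submodule.span ℝ {n})ᗮ =>
        (q.1 / δ) ^ (d - 1) * g (c + (q.1 / δ) • (δ • n + (q.2 : Space d))) := by fun_prop
    rw [Measure.prod_restrict]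
    exact (hAc.continuousOn.integrableOn_compact
      (isCompact_Icc.prod (isCompact_closedBall (0 : (Submodule.span ℝ {n})ᗮ) R))).mono_set
      (Set.prod_mono Set.Ioo_subset_Icc_self hR)

/-! ### Star-shaped sets -/

/-- The points `(1 - s) y + s z`, with `y` in the ball of star centres, fill a neighbourhood of `c +
s (z - c)` inside `closure K`. Regularity of `K` turns this interior point of the closure into a
point of `K`. -/
theorem radial_mem {K : Set (Space d)} (hreg : interior (closure K) = K) {c : Space d} {ρ : ℝ}
    (hρ : 0 < ρ) (hstar : ∀ y ∈ Metric.ball c ρ, StarConvex ℝ y K) {z : Space d}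
    (hz : z ∈ closure K) {s : ℝ} (hs0 : 0 ≤ s) (hs1 : s < 1) : c + s • (z - c) ∈ K := by
  have h1 : 0 < 1 - s := by linarith
  rw [← hreg, mem_interior]
  refine ⟨(fun x => (1 - s)⁻¹ • (x - s • z)) ⁻¹' Metric.ball c ρ, fun x hx => ?_,
    Metric.isOpen_ball.preimage (by fun_prop), ?_⟩
  · set y := (1 - s)⁻¹ • (x - s • z) with hy
    have h2 : ∀ w ∈ K, (1 - s) • y + s • w ∈ K := fun w hw =>
      hstar y hx hw h1.le hs0 (by ring)
    have h3 : Continuous fun w : Space d => (1 - s) • y + s • w := by fun_prop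
    have h4 := map_mem_closure h3 hz h2
    rwa [hy, smul_inv_smul₀ h1.ne', sub_add_cancel] at h4
  · have : (1 - s)⁻¹ • (c + s • (z - c) - s • z) = c := by
      rw [inv_smul_eq_iff₀ h1.ne']; module
    simpa [this] using hρ

/-- Of two distinct frontier points on one ray the nearer would lie in `K` by `radial_mem`, which is
impossible for open `K`. This makes the cones over different faces disjoint. -/
theorem frontier_radial_injective {K : Set (Space d)} (ho : IsOpen K)
    (hreg : interior (closure K) = K) {c : Space d} {ρ : ℝ} (hρ : 0 < ρ)
    (hstar : ∀ y ∈ Metric.ball c ρ, StarConvex ℝ y K) {x x' : Space d} (hx : x ∈ frontier K)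
    (hx' : x' ∈ frontier K) {s s' : ℝ} (hs : 0 < s) (hs' : 0 < s')
    (h : s • (x - c) = s' • (x' - c)) : x = x' := by
  have key : ∀ {x x' : Space d} {s s' : ℝ}, x ∈ frontier K → x' ∈ frontier K → 0 < s → 0 < s' →
      s • (x - c) = s' • (x' - c) → ¬ s < s' := by
    intro x x' s s' hx hx' hs hs' h hlt
    have h1 := radial_mem hreg hρ hstar (frontier_subset_closure hx) (s := s / s')
      (by positivity) (by rwa [div_lt_one hs'])
    have h2 : c + (s / s') • (x - c) = x' := by
      rw [div_eq_inv_mul, mul_smul, h, inv_smul_smul₀ hs'.ne']; abel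
    rw [h2] at h1
    exact (ho.frontier_eq ▸ hx').2 h1
  have hss : s = s' := le_antisymm (not_lt.1 (key hx' hx hs' hs h.symm)) (not_lt.1 (key hx hx' hs hs' h))
  subst hss
  simpa using (smul_right_injective _ hs.ne') h

/-- The ray from `c` through `y` must leave the bounded set `K` beyond `y`; by connectedness it
meets the frontier there. -/
theorem exists_frontier_radial {K : Set (Space d)} (ho : IsOpen K) (hb : Bornology.IsBounded K)
    {c y : Space d} (hy : y ∈ K) (hyc : y ≠ c) :
    ∃ s ∈ Set.Ioo (0 : ℝ) 1, ∃ x ∈ frontier K, y = c + s • (x - c) := by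
  have hpre : IsPreconnected ((fun r : ℝ => c + r • (y - c)) '' Set.Ici 1) :=
    isPreconnected_Ici.image _ (by fun_prop)
  have hyc' : 0 < ‖y - c‖ := norm_pos_iff.2 (sub_ne_zero.2 hyc)
  obtain ⟨r, hr, hx⟩ : ∃ r ∈ Set.Ici (1 : ℝ), c + r • (y - c) ∈ frontier K := by
    by_contra! hfr
    have hcl : ∀ r ∈ Set.Ici (1 : ℝ), c + r • (y - c) ∉ K → c + r • (y - c) ∉ closure K :=
      fun r hr h1 h2 => hfr r hr (ho.frontier_eq ▸ ⟨h2, h1⟩)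
    obtain ⟨R, hR⟩ := hb.subset_closedBall c
    have hfar : c + max 1 ((R + 1) / ‖y - c‖) • (y - c) ∉ K := fun h => by
      have h1 := hR h
      rw [mem_closedBall_iff_norm, add_sub_cancel_left, norm_smul,
        Real.norm_of_nonneg (le_trans zero_le_one (le_max_left _ _))] at h1
      have h2 := mul_le_mul_of_nonneg_right (le_max_right 1 ((R + 1) / ‖y - c‖)) hyc'.le
      rw [div_mul_cancel₀ _ hyc'.ne'] at h2
      linarith
    have hfar1 : max 1 ((R + 1) / ‖y - c‖) ∈ Set.Ici (1 : ℝ) := Set.mem_Ici.2 (le_max_left _ _)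
    obtain ⟨z, -, hz1, hz2⟩ := hpre K (closure K)ᶜ ho isClosed_closure.isOpen_compl
      (by
        rintro _ ⟨r, hr, rfl⟩
        by_cases h : c + r • (y - c) ∈ K
        · exact Or.inl h
        · exact Or.inr (hcl r hr h))
      ⟨y, ⟨1, Set.self_mem_Ici, by simp⟩, hy⟩ ⟨_, ⟨_, hfar1, rfl⟩, hcl _ hfar1 hfar⟩
    exact hz2 (subset_closure hz1)
  have hr1 : 1 < r := by
    refine lt_of_le_of_ne hr fun h => ?_
    rw [← h] at hx
    simp only [one_smul, add_sub_cancel] at hx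
    exact (ho.frontier_eq ▸ hx).2 hy
  have hr0 : 0 < r := by linarith
  refine ⟨r⁻¹, ⟨by positivity, inv_lt_one_of_one_lt₀ hr1⟩, _, hx, ?_⟩
  rw [add_sub_cancel_left, inv_smul_smul₀ hr0.ne']; abel

/-! ### Flat faces -/

/-- A relatively open piece of a hyperplane determines its normal direction: every direction `v ⟂ n`
is realised by a short step inside `S`, so `m ⟂ v`. -/
theorem eq_inner_smul_of_mem_nhdsWithin {S : Set (Space d)} {n m x : Space d} (hn : ‖n‖ = 1)
    (hS : S ∈ 𝓝[{z | inner ℝ n z = inner ℝ n x}] x) (hm : ∀ y ∈ S, inner ℝ m (y - x) = 0) :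
    m = (inner ℝ n m : ℝ) • n := by
  have horth : ∀ v, inner ℝ n v = 0 → inner ℝ m v = 0 := by
    intro v hv
    have htend : Tendsto (fun s : ℝ => x + s • v) (𝓝[>] 0)
        (𝓝[{y | inner ℝ n y = inner ℝ n x}] x) := by
      refine tendsto_nhdsWithin_iff.2 ⟨?_, Eventually.of_forall fun s => ?_⟩
      · have : Continuous fun s : ℝ => x + s • v := by fun_prop
        have h := (this.tendsto 0).mono_left (nhdsWithin_le_nhds (s := Set.Ioi 0))
        simpa using h
      · simp [inner_add_right, inner_smul_right, hv]
    obtain ⟨s, hs, hs0⟩ := ((htend.eventually hS).and self_mem_nhdsWithin).exists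
    have h1 := hm _ hs
    rw [add_sub_cancel_left, inner_smul_right] at h1
    exact (mul_eq_zero.1 h1).resolve_left (ne_of_gt hs0)
  have h1 : inner ℝ n (m - (inner ℝ n m : ℝ) • n) = (0 : ℝ) := by
    rw [inner_sub_right, inner_smul_right, real_inner_self_eq_norm_sq, hn]; ring
  have h3 : inner ℝ (m - (inner ℝ n m : ℝ) • n) (m - (inner ℝ n m : ℝ) • n) = (0 : ℝ) := by
    nth_rw 1 [inner_sub_left]
    rw [inner_smul_left, h1, horth _ h1]; simp
  exact sub_eq_zero.1 (inner_self_eq_zero.1 h3)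

/-- The normal in `IsFlatFace.flat` is merely some normal, whereas `normal K e` is separate data of
the mesh. The two are parallel, so the face may be described with either. -/
theorem IsFlatFace.eq_of_normal {e : Set (Space d)} (he : IsFlatFace e) {n : Space d}
    (hn : ‖n‖ = 1) (hperp : ∀ x ∈ e, ∀ y ∈ e, inner ℝ n (x - y) = 0) {x₀ : Space d}
    (hx₀ : x₀ ∈ e) :
    e = {x | inner ℝ n x = inner ℝ n x₀ ∧ closure e ∈ 𝓝[{y | inner ℝ n y = inner ℝ n x₀}] x} := by
  obtain ⟨m, a, hm, hU⟩ := he.flat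
  have hx₀' := hU ▸ hx₀
  have hcl : ∀ y ∈ closure e, inner ℝ n (y - x₀) = 0 := by
    have : IsClosed {y : Space d | inner ℝ n (y - x₀) = 0} :=
      isClosed_eq (by fun_prop) continuous_const
    exact fun y hy => closure_minimal (fun y hy => hperp y hy x₀ hx₀) this hy
  have hn' : n = (inner ℝ m n : ℝ) • m := by
    refine eq_inner_smul_of_mem_nhdsWithin (x := x₀) hm ?_ hcl
    rw [hx₀'.1]
    exact hx₀'.2
  have hne : (inner ℝ m n : ℝ) ≠ 0 := by
    intro h; rw [h, zero_smul] at hn'; simp [hn'] at hn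
  have hplane : {y : Space d | inner ℝ n y = inner ℝ n x₀} = {y | inner ℝ m y = a} := by
    ext y
    simp only [Set.mem_ofPred_eq]
    rw [hn', inner_smul_left, inner_smul_left, hx₀'.1]
    exact mul_right_inj' (by simpa using hne)
  rw [hplane]
  nth_rw 1 [hU]
  ext x
  have := Set.ext_iff.1 hplane x
  simp only [Set.mem_ofPred_eq] at this ⊢
  rw [this]

theorem IsFlatFace.measurableSet {e : Set (Space d)} (he : IsFlatFace e) : MeasurableSet e := by
  obtain ⟨m, a, hm, hU⟩ := he.flat
  have h : e = {y | inner ℝ m y = a} ∩ interior {y | inner ℝ m y = a → y ∈ closure e} := by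
    nth_rw 1 [hU]
    ext x
    simp only [Set.mem_ofPred_eq, Set.mem_inter_iff, mem_interior_iff_mem_nhds]
    refine and_congr_right fun _ => ?_
    rw [mem_nhdsWithin_iff_eventually]
    rfl
  rw [h]
  exact (isClosed_eq (by fun_prop) continuous_const).measurableSet.inter
    isOpen_interior.measurableSet

theorem volume_frontier_biUnion_eq_zero {E ι : Type*} [NormedAddCommGroup E]
    [InnerProductSpace ℝ E] [FiniteDimensional ℝ E] [MeasurableSpace E] [BorelSpace E]
    (F : Finset ι) (S : ι → Set E) (hS : ∀ s ∈ F, Convex ℝ (S s)) :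
    volume (frontier (⋃ s ∈ F, S s)) = 0 := by
  induction F using Finset.induction_on with
  | empty => simp
  | insert a F ha ih =>
    rw [Finset.set_biUnion_insert]
    refine measure_mono_null (frontier_union_subset _ _) (measure_union_null ?_ ?_)
    · exact measure_mono_null Set.inter_subset_left
        ((hS a (Finset.mem_insert_self _ _)).addHaar_frontier volume)
    · exact measure_mono_null Set.inter_subset_right
        (ih fun s hs => hS s (Finset.mem_insert_of_mem hs))

/-- In the coordinates of the hyperplane the relative boundary of `e` lies in the frontier of a
finite union of convex sets, and convex sets have null frontier. -/
theorem IsFlatFace.volume_boundary_eq_zero {e : Set (Space d)} (he : IsFlatFace e) {n c : Space d}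
    (hn : ‖n‖ = 1) {δ : ℝ} (hδ : ∀ x ∈ e, inner ℝ n (x - c) = δ) :
    volume {v : (Submodule.span ℝ {n})ᗮ | planeParam c n (δ, v) ∈ closure e \ e} = 0 := by
  set φ := fun v : (Submodule.span ℝ {n})ᗮ => planeParam c n (δ, v) with hφ
  have hiso := isometry_planeParam c n δ
  obtain ⟨x₀, hx₀⟩ := he.isConnected.nonempty
  have hU := he.eq_of_normal hn (fun x hx y hy => by
    rw [← sub_sub_sub_cancel_right x y c, inner_sub_right, hδ x hx, hδ y hy, sub_self]) hx₀
  have hrange : Set.range φ = {y | inner ℝ n y = inner ℝ n x₀} := by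
    have h0 := hδ x₀ hx₀
    rw [inner_sub_right] at h0
    ext y
    constructor
    · rintro ⟨v, rfl⟩
      have := inner_planeParam c hn (δ, v)
      rw [inner_sub_right] at this
      simp only [Set.mem_ofPred_eq, hφ]
      linarith
    · intro hy
      refine exists_planeParam c hn ?_
      rw [inner_sub_right]
      have : inner ℝ n y = inner ℝ n x₀ := hy
      linarith
  have hsub : {v | φ v ∈ closure e \ e} ⊆ frontier (φ ⁻¹' closure e) := by
    rintro v ⟨hv1, hv2⟩
    refine ⟨subset_closure hv1, fun hv3 => hv2 ?_⟩
    rw [mem_interior_iff_mem_nhds] at hv3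
    have hv4 : closure e ∈ map φ (𝓝 v) := hv3
    rw [hiso.isEmbedding.map_nhds_eq, hrange] at hv4
    rw [hU]
    refine ⟨?_, hv4⟩
    have : φ v ∈ Set.range φ := ⟨v, rfl⟩
    rwa [hrange] at this
  obtain ⟨F, hF⟩ := he.polyhedral
  refine measure_mono_null hsub ?_
  rw [hF, Set.preimage_iUnion₂]
  refine volume_frontier_biUnion_eq_zero F _ fun s _ => ?_
  have h1 := (convex_convexHull ℝ (s : Set (Space d))).translate_preimage_right (c + δ • n)
  exact h1.linear_preimage (Submodule.span ℝ {n})ᗮ.subtype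

/-! ### Position of star centres relative to the hyperplanes of the faces. -/

namespace PolyMesh

variable {Ω : Set (Space d)} (M : PolyMesh Ω)

theorem mem_facesOf {K : M.cells} {e : M.faces} :
    e ∈ M.facesOf K ↔ (e : Set (Space d)) ⊆ frontier (K : Set (Space d)) := by
  simp [facesOf]

theorem cell_bounded (K : M.cells) : Bornology.IsBounded (K : Set (Space d)) :=
  (M.cell_polyhedron K K.2).polyhedral.isCompact.isBounded.subset subset_closure

/-- A point of the face `e`. -/
def facePoint (e : M.faces) : Space d := (M.face_flat e e.2).isConnected.nonempty.some

theorem facePoint_mem (e : M.faces) : M.facePoint e ∈ (e : Set (Space d)) :=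
  (M.face_flat e e.2).isConnected.nonempty.some_mem

/-- The signed distance of `c` to the hyperplane through the face `e` of `K`. -/
def offset (K : M.cells) (e : M.faces) (c : Space d) : ℝ :=
  inner ℝ (M.normal K e) (M.facePoint e - c)

theorem norm_normal {K : M.cells} {e : M.faces} (he : e ∈ M.facesOf K) : ‖M.normal K e‖ = 1 :=
  (M.normal_spec K K.2 e e.2 (M.mem_facesOf.1 he)).1

theorem inner_eq_offset {K : M.cells} {e : M.faces} (he : e ∈ M.facesOf K) (c : Space d)
    {x : Space d} (hx : x ∈ closure (e : Set (Space d))) :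
    inner ℝ (M.normal K e) (x - c) = M.offset K e c := by
  have h : IsClosed {x : Space d | inner ℝ (M.normal K e) (x - c) = M.offset K e c} :=
    isClosed_eq (by fun_prop) continuous_const
  refine closure_minimal (fun y hy => ?_) h hx
  have h1 := (M.normal_spec K K.2 e e.2 (M.mem_facesOf.1 he)).2.1 y hy _ (M.facePoint_mem e)
  rw [Set.mem_ofPred_eq, offset, ← sub_eq_zero, ← inner_sub_right, sub_sub_sub_cancel_right, h1]

theorem face_eq {K : M.cells} {e : M.faces} (he : e ∈ M.facesOf K) {x : Space d}
    (hx : x ∈ (e : Set (Space d))) : (e : Set (Space d)) =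
      {y | inner ℝ (M.normal K e) y = inner ℝ (M.normal K e) x ∧
        closure (e : Set (Space d)) ∈ 𝓝[{y | inner ℝ (M.normal K e) y = inner ℝ (M.normal K e) x}] y} :=
  (M.face_flat e e.2).eq_of_normal (M.norm_normal he)
    (M.normal_spec K K.2 e e.2 (M.mem_facesOf.1 he)).2.1 hx

/-- If `y` were strictly on the outer side of the face, a segment from `y` to a point of `K` just
inside the face would cross the face. That crossing point would lie both in `K`, by star-shapedness,
and on its frontier. -/
theorem offset_nonneg {K : M.cells} {e : M.faces} (he : e ∈ M.facesOf K) {y : Space d}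
    (hy : StarConvex ℝ y (K : Set (Space d))) : 0 ≤ M.offset K e y := by
  by_contra! hneg
  set n := M.normal K e
  set x := M.facePoint e
  have hx := M.facePoint_mem e
  have hn : ‖n‖ = 1 := M.norm_normal he
  set a := -M.offset K e y with ha
  have ha0 : 0 < a := by linarith
  have hay : inner ℝ n (y - x) = a := by
    rw [ha, offset, ← inner_neg_right, neg_sub]
  -- The heights of `y` and `x - s n` above the hyperplane are `a` and `-s`, so the segment between
  -- them crosses it at parameter `s / (a + s)`; the crossing point tends to `x` as `s → 0`.
  have hcross : Tendsto (fun s : ℝ => (x - s • n) + (s / (a + s)) • (y - (x - s • n))) (𝓝[>] 0)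
      (𝓝[{z | inner ℝ n z = inner ℝ n x}] x) := by
    refine tendsto_nhdsWithin_iff.2 ⟨?_, ?_⟩
    · have h : ContinuousAt (fun s : ℝ => (x - s • n) + (s / (a + s)) • (y - (x - s • n))) 0 := by
        have : a + 0 ≠ 0 := by simpa using ha0.ne'
        fun_prop (disch := assumption)
      have h2 := h.tendsto.mono_left (nhdsWithin_le_nhds (s := Set.Ioi 0))
      simpa using h2
    · filter_upwards [self_mem_nhdsWithin] with s hs
      have hs0 : 0 < s := hs
      have h1 : y - (x - s • n) = (y - x) + s • n := by abel
      have hnn : inner ℝ n n = (1 : ℝ) := by rw [real_inner_self_eq_norm_sq, hn]; norm_num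
      rw [h1, inner_add_right, inner_sub_right, inner_smul_right,
        inner_smul_right, inner_add_right, inner_smul_right, hay, hnn]
      field_simp
      ring
  have hcl : closure (e : Set (Space d)) ∈ 𝓝[{z | inner ℝ n z = inner ℝ n x}] x := by
    have h := hx
    rw [M.face_eq he hx] at h
    exact h.2
  obtain ⟨s, ⟨hs1, hs2⟩, hs0⟩ := (((hcross.eventually hcl).and
    ((M.normal_spec K K.2 e e.2 (M.mem_facesOf.1 he)).2.2 x hx)).and self_mem_nhdsWithin).exists
  have hs0' : 0 < s := hs0
  have hmem := hy hs2.1 (a := s / (a + s)) (b := a / (a + s)) (by positivity) (by positivity)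
    (by field_simp; ring)
  have heq : (s / (a + s)) • y + (a / (a + s)) • (x - s • n) =
      (x - s • n) + (s / (a + s)) • (y - (x - s • n)) := by
    have : a / (a + s) = 1 - s / (a + s) := by field_simp; ring
    rw [this]; module
  change (s / (a + s)) • y + (a / (a + s)) • (x - s • n) ∈ (K : Set (Space d)) at hmem
  rw [heq] at hmem
  have h3 := closure_minimal (M.mem_facesOf.1 he) isClosed_frontier hs1
  rw [(M.cell_polyhedron K K.2).isOpen.frontier_eq] at h3
  exact h3.2 hmem

theorem offset_sub (K : M.cells) (e : M.faces) (c v : Space d) :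
    M.offset K e (c - v) = M.offset K e c + inner ℝ (M.normal K e) v := by
  simp only [offset, inner_sub_right]; ring

/-- Moving the star centre by `r < ρ` towards the face keeps it a star centre and lowers its offset
by `r`. The bound `θ h_K` obtained in this way makes the trace constant independent of the shape of
the faces. -/
theorem le_offset {K : M.cells} {e : M.faces} (he : e ∈ M.facesOf K) {c : Space d} {ρ : ℝ}
    (hρ : 0 < ρ) (hstar : ∀ y ∈ Metric.ball c ρ, StarConvex ℝ y (K : Set (Space d))) :
    ρ ≤ M.offset K e c := by
  refine le_of_forall_lt_imp_le_of_dense fun r hr => ?_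
  have hn := M.norm_normal he
  rcases le_or_gt r 0 with hr0 | hr0
  · exact hr0.trans (M.offset_nonneg he (hstar c (Metric.mem_ball_self hρ)))
  · have h1 := M.offset_nonneg he (y := c - (-r) • M.normal K e) (hstar _ (by
      simp [norm_smul, hn, abs_of_pos hr0, hr]))
    rw [offset_sub, inner_smul_right, real_inner_self_eq_norm_sq, hn] at h1
    linarith

end PolyMesh

namespace PolyMesh

variable {Ω : Set (Space d)} (M : PolyMesh Ω)

/-! ### The divergence theorem on star-shaped cells -/

theorem integrableOn_cell (K : M.cells) (p : MvPolynomial (Fin d) ℝ) :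
    IntegrableOn (ev p) (K : Set (Space d)) volume :=
  have hc := (M.cell_polyhedron K K.2).polyhedral.isCompact
  integrable_ev hc ((measure_mono subset_closure).trans_lt hc.measure_lt_top) p

theorem integrableOn_face (e : M.faces) (p : MvPolynomial (Fin d) ℝ) :
    IntegrableOn (ev p) (e : Set (Space d)) (μHE[d - 1]) :=
  integrable_ev (M.face_flat e e.2).polyhedral.isCompact (M.face_flat e e.2).measure_lt_top p

/-- `p ↦ ∫_K p` as a linear functional. -/
def cellFunctional (K : M.cells) : MvPolynomial (Fin d) ℝ →ₗ[ℝ] ℝ :=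
  intFunctional volume (K : Set (Space d)) (M.integrableOn_cell K)

/-- `p ↦ ∫_e p` as a linear functional. -/
def faceFunctional (e : M.faces) : MvPolynomial (Fin d) ℝ →ₗ[ℝ] ℝ :=
  intFunctional (μHE[d - 1]) (e : Set (Space d)) (M.integrableOn_face e)

theorem cellInt_eq (K : M.cells) (p : MvPolynomial (Fin d) ℝ) :
    cellInt K.1 p = M.cellFunctional K p := rfl

theorem faceInt_eq_functional (e : M.faces) (p : MvPolynomial (Fin d) ℝ) :
    faceInt e.1 p = M.faceFunctional e p := rfl

variable {M} in
theorem cone_face_subset {K : M.cells} {e : M.faces} (he : e ∈ M.facesOf K) {c : Space d} {ρ : ℝ}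
    (hρ : 0 < ρ) (hstar : ∀ y ∈ Metric.ball c ρ, StarConvex ℝ y (K : Set (Space d)))
    {A : Set (Space d)} (hA : A ⊆ closure (e : Set (Space d))) :
    cone c (M.normal K e) (M.offset K e c) A ⊆ K := by
  intro y hy
  obtain ⟨s, hs, x, hx, rfl⟩ := (mem_cone_iff (fun x hx => M.inner_eq_offset he c (hA hx))
    (hρ.trans_le (M.le_offset he hρ hstar))).1 hy
  refine radial_mem (M.cell_polyhedron K K.2).regular hρ hstar ?_ hs.1.le hs.2
  exact frontier_subset_closure
    (closure_minimal (M.mem_facesOf.1 he) isClosed_frontier (hA hx))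

variable {M} in
-- Apply `integral_cone` with `p = 1`: `d` times the volume of the cone equals `δ` times the surface
-- measure of its base, which is zero.
theorem volume_cone_boundary_eq_zero {K : M.cells} {e : M.faces} (he : e ∈ M.facesOf K)
    {c : Space d} {ρ : ℝ} (hρ : 0 < ρ)
    (hstar : ∀ y ∈ Metric.ball c ρ, StarConvex ℝ y (K : Set (Space d))) :
    volume (cone c (M.normal K e) (M.offset K e c)
      (closure (e : Set (Space d)) \ (e : Set (Space d)))) = 0 := by
  have hflat := M.face_flat e e.2
  have hn := M.norm_normal he
  have hδ := hρ.trans_le (M.le_offset he hρ hstar)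
  have hint := integral_cone hn hδ
    (isClosed_closure.measurableSet.diff hflat.measurableSet)
    (hflat.polyhedral.isCompact.isBounded.subset Set.sdiff_subset)
    (fun x hx => M.inner_eq_offset he c hx.1) 1
  rw [faceInt_eq c hn (fun x hx => M.inner_eq_offset he c hx.1),
    setIntegral_measure_zero _ (hflat.volume_boundary_eq_zero hn
      fun x hx => M.inner_eq_offset he c (subset_closure hx)), mul_zero] at hint
  have h1 : ev (radialDiv c (1 : MvPolynomial (Fin d) ℝ)) = fun _ => (d : ℝ) := by
    ext x; simp [ev, radialDiv]
  rw [h1, setIntegral_const, smul_eq_mul, mul_eq_zero] at hint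
  have h2 := hint.resolve_right (by exact_mod_cast (dim_pos hn).ne')
  exact (measureReal_eq_zero_iff ((measure_mono (cone_face_subset he hρ hstar
    Set.sdiff_subset)).trans_lt (M.cell_bounded K).measure_lt_top).ne).1 h2

variable {M} in
-- Each point of `K` other than `c` lies on a segment from `c` to a frontier point, and that point
-- is in the closure of some face. The exceptional points lie in cones over relative face
-- boundaries, which are null.
theorem cell_ae_eq_iUnion_cone (hd : 0 < d) (K : M.cells) {c : Space d} {ρ : ℝ} (hρ : 0 < ρ)
    (hstar : ∀ y ∈ Metric.ball c ρ, StarConvex ℝ y (K : Set (Space d))) :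
    (⋃ e ∈ M.facesOf K, cone c (M.normal K e) (M.offset K e c) e : Set (Space d))
      =ᵐ[volume] (K : Set (Space d)) := by
  have hK := M.cell_polyhedron K K.2
  refine (LE.le.eventuallyLE (Set.iUnion₂_subset fun e he =>
    cone_face_subset he hρ hstar subset_closure)).antisymm ?_
  have : Nonempty (Fin d) := ⟨⟨0, hd⟩⟩
  have hnull : volume ({c} ∪ ⋃ e ∈ M.facesOf K, cone c (M.normal K e) (M.offset K e c)
      (closure (e : Set (Space d)) \ (e : Set (Space d)))) = 0 := by
    refine measure_union_null (measure_singleton c) ?_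
    refine (measure_biUnion_null_iff (M.facesOf K).countable_toSet).2 ?_
    exact fun e he => volume_cone_boundary_eq_zero he hρ hstar
  filter_upwards [compl_mem_ae_iff.2 hnull] with y hy hyK
  by_contra hcon
  refine hy ?_
  by_cases hyc : y = c
  · exact Or.inl hyc
  obtain ⟨s, hs, x, hx, rfl⟩ := exists_frontier_radial hK.isOpen (M.cell_bounded K) hyK hyc
  rw [M.frontier_cell K K.2] at hx
  simp only [Set.mem_iUnion, exists_prop] at hx
  obtain ⟨e, he, hxe⟩ := hx
  have he' : e ∈ M.faces ∧ e ⊆ frontier (K : Set (Space d)) := by simpa using he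
  have hmem : (⟨e, he'.1⟩ : M.faces) ∈ M.facesOf K := M.mem_facesOf.2 he'.2
  have hδ := hρ.trans_le (M.le_offset hmem hρ hstar)
  refine Or.inr (Set.mem_iUnion₂.2 ⟨_, hmem, ?_⟩)
  refine (mem_cone_iff (fun x hx => M.inner_eq_offset hmem c hx.1) hδ).2
    ⟨s, hs, x, ⟨hxe, fun hxe' => hcon (Set.mem_iUnion₂.2 ⟨_, hmem, ?_⟩)⟩, rfl⟩
  exact (mem_cone_iff (fun x hx => M.inner_eq_offset hmem c (subset_closure hx)) hδ).2
    ⟨s, hs, x, hxe', rfl⟩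

variable {M} in
theorem cellInt_radialDiv (hd : 0 < d) (K : M.cells) {c : Space d} {ρ : ℝ} (hρ : 0 < ρ)
    (hstar : ∀ y ∈ Metric.ball c ρ, StarConvex ℝ y (K : Set (Space d)))
    (p : MvPolynomial (Fin d) ℝ) :
    cellInt K.1 (radialDiv c p) = ∑ e ∈ M.facesOf K, M.offset K e c * faceInt e.1 p := by
  have hK := M.cell_polyhedron K K.2
  have hδ : ∀ e ∈ M.facesOf K, 0 < M.offset K e c := fun e he =>
    hρ.trans_le (M.le_offset he hρ hstar)
  have hoff : ∀ e ∈ M.facesOf K, ∀ x ∈ (e : Set (Space d)),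
      inner ℝ (M.normal K e) (x - c) = M.offset K e c := fun e he x hx =>
    M.inner_eq_offset he c (subset_closure hx)
  unfold cellInt
  rw [← setIntegral_congr_set (cell_ae_eq_iUnion_cone hd K hρ hstar), integral_biUnion_finset]
  · refine Finset.sum_congr rfl fun e he => ?_
    have hflat := M.face_flat e e.2
    exact integral_cone (M.norm_normal he) (hδ e he) hflat.measurableSet
      (hflat.polyhedral.isCompact.isBounded.subset subset_closure) (hoff e he) p
  · exact fun e _ => measurableSet_cone _ _ _ (M.face_flat e e.2).measurableSet
  · intro e he e' he' hne
    rw [Function.onFun, Set.disjoint_left]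
    intro y hy hy'
    obtain ⟨s, hs, x, hx, rfl⟩ := (mem_cone_iff (hoff e he) (hδ e he)).1 hy
    obtain ⟨s', hs', x', hx', h⟩ := (mem_cone_iff (hoff e' he') (hδ e' he')).1 hy'
    have hxx := frontier_radial_injective hK.isOpen hK.regular hρ hstar
      (M.mem_facesOf.1 he hx) (M.mem_facesOf.1 he' hx') hs.1 hs'.1 (add_left_cancel h)
    exact Set.disjoint_left.1 (M.face_disjoint e e.2 e' e'.2 fun h => hne (Subtype.ext h)) hx
      (hxx ▸ hx')
  · exact fun e he => (M.integrableOn_cell K _).mono_set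
      (cone_face_subset he hρ hstar subset_closure)

variable {M} in
-- `cellInt_radialDiv` holds for every apex in the ball of star centres. Shifting the apex by `ρ/2`
-- along the `i`-th axis changes the integrand by `(ρ/2) ∂_i p` and each offset by `(ρ/2) n_i`; the
-- difference of the two identities is the claim.
theorem cellInt_pderiv (K : M.cells) {c : Space d} {ρ : ℝ} (hρ : 0 < ρ)
    (hstar : ∀ y ∈ Metric.ball c ρ, StarConvex ℝ y (K : Set (Space d))) (i : Fin d)
    (p : MvPolynomial (Fin d) ℝ) :
    cellInt K.1 (MvPolynomial.pderiv i p) =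
      ∑ e ∈ M.facesOf K, M.normal K e i * faceInt e.1 p := by
  have hd : 0 < d := i.pos
  set v : Space d := (ρ / 2) • EuclideanSpace.single i (1 : ℝ) with hv
  -- Half of the radius pays for the shift, the other half remains as a ball of star centres around
  -- the new apex.
  have hsub : Metric.ball (c - v) (ρ / 2) ⊆ Metric.ball c ρ := by
    refine Metric.ball_subset_ball' ?_
    rw [dist_eq_norm, sub_sub_cancel_left, norm_neg, hv, norm_smul, Real.norm_of_nonneg (by linarith)]
    simp
  have h1 := cellInt_radialDiv hd K hρ hstar p
  have h2 := cellInt_radialDiv hd K (half_pos hρ) (fun y hy => hstar y (hsub hy)) p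
  have h3 : radialDiv (c - v) p =
      radialDiv c p + MvPolynomial.C (ρ / 2) * MvPolynomial.pderiv i p := by
    have : ∀ j, (MvPolynomial.X j - MvPolynomial.C ((c - v) j)) * MvPolynomial.pderiv j p =
        (MvPolynomial.X j - MvPolynomial.C (c j)) * MvPolynomial.pderiv j p +
        if j = i then MvPolynomial.C (ρ / 2) * MvPolynomial.pderiv i p else 0 := by
      intro j
      split_ifs with h
      · subst h
        simp [hv]
        ring
      · simp [hv, h]
    simp only [radialDiv, this, Finset.sum_add_distrib, Finset.sum_ite_eq', Finset.mem_univ,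
      if_true]
    ring
  simp only [offset_sub, hv, inner_smul_right, EuclideanSpace.inner_single_right, add_mul,
    Finset.sum_add_distrib] at h2
  rw [h3, cellInt_eq, map_add, ← cellInt_eq, h1, add_right_inj, ← MvPolynomial.smul_eq_C_mul,
    map_smul, ← cellInt_eq, smul_eq_mul] at h2
  have h4 : ρ / 2 ≠ 0 := by positivity
  refine mul_left_cancel₀ h4 (h2.trans ?_)
  rw [Finset.mul_sum]
  exact Finset.sum_congr rfl fun e _ => by simp; ring

/-! ### Cancellation of the normals -/

theorem face_subset_or (e : M.faces) :
    ((e : Set (Space d)) ⊆ frontier Ω) ∨ ∃ K K' : M.cells, K ≠ K' ∧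
      (∀ L : M.cells, e ∈ M.facesOf L ↔ L = K ∨ L = K') := by
  rcases M.face_cells e e.2 with ⟨-, h⟩ | ⟨h, -⟩
  · obtain ⟨K, K', hne, hKK⟩ := Finset.card_eq_two.1 h
    have hm : ∀ L, (L ∈ M.cells ∧ (e : Set (Space d)) ⊆ frontier L) ↔ L = K ∨ L = K' := fun L => by
      have := Finset.ext_iff.1 hKK L
      simpa using this
    refine Or.inr ⟨⟨K, ((hm K).2 (Or.inl rfl)).1⟩, ⟨K', ((hm K').2 (Or.inr rfl)).1⟩,
      fun h => hne (congrArg Subtype.val h), fun L => ?_⟩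
    rw [mem_facesOf, Subtype.ext_iff, Subtype.ext_iff, ← hm L]
    simp
  · exact Or.inl h

/-- Both vectors are unit normals of one hyperplane, hence equal or opposite. If they were equal,
points just behind the face would belong to both of two disjoint cells. -/
theorem normal_add_eq_zero {K K' : M.cells} (hne : K ≠ K') {e : M.faces} (he : e ∈ M.facesOf K)
    (he' : e ∈ M.facesOf K') : M.normal K e + M.normal K' e = 0 := by
  set n := M.normal K e
  set m := M.normal K' e
  have hn : ‖n‖ = 1 := M.norm_normal he
  have hm : ‖m‖ = 1 := M.norm_normal he'
  have hx := M.facePoint_mem e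
  set x := M.facePoint e
  have hspec := (M.normal_spec K K.2 e e.2 (M.mem_facesOf.1 he)).2
  have hspec' := (M.normal_spec K' K'.2 e e.2 (M.mem_facesOf.1 he')).2
  have hcl : closure (e : Set (Space d)) ∈ 𝓝[{z | inner ℝ n z = inner ℝ n x}] x := by
    have h := hx
    rw [M.face_eq he hx] at h
    exact h.2
  have hmn : m = (inner ℝ n m : ℝ) • n := eq_inner_smul_of_mem_nhdsWithin hn hcl fun y hy => by
    rw [M.inner_eq_offset he' x hy, ← M.inner_eq_offset he' x (subset_closure hx), sub_self,
      inner_zero_right]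
  have habs : |(inner ℝ n m : ℝ)| = 1 := by
    have := congrArg norm hmn
    rwa [norm_smul, hn, hm, mul_one, Real.norm_eq_abs, eq_comm] at this
  rcases eq_or_eq_neg_of_abs_eq habs with h | h
  · rw [h, one_smul] at hmn
    obtain ⟨s, h1, h2⟩ := ((hspec.2 x hx).and (hspec'.2 x hx)).exists
    refine absurd h2.1 fun h3 => ?_
    have hdis := M.cell_disjoint K K.2 K' K'.2 fun h => hne (Subtype.ext h)
    refine Set.disjoint_left.1 hdis h1.1 ?_
    change x - s • m ∈ _ at h3
    rwa [hmn] at h3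
  · rw [hmn, h]; simp

/-- Exchange the sums: an interior face is met from exactly two cells with opposite normals, and `φ`
vanishes on the boundary faces. It requires `φ` to be single-valued on each face, which is why it is
applied to `μ` and not to traces of `w`. -/
theorem sum_normal_mul_eq_zero (φ : M.faces → ℝ)
    (hφ : ∀ e : M.faces, (e : Set (Space d)) ⊆ frontier Ω → φ e = 0) (i : Fin d) :
    ∑ K : M.cells, ∑ e ∈ M.facesOf K, M.normal K e i * φ e = 0 := by
  have h1 : ∀ K : M.cells, ∑ e ∈ M.facesOf K, M.normal K e i * φ e =
      ∑ e : M.faces, if e ∈ M.facesOf K then M.normal K e i * φ e else 0 := fun K => by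
    rw [Finset.sum_ite_mem, Finset.univ_inter]
  simp only [h1]
  rw [Finset.sum_comm]
  refine Finset.sum_eq_zero fun e _ => ?_
  rcases M.face_subset_or e with h | ⟨K, K', hne, h⟩
  · simp [hφ e h]
  · have h2 : ∀ L : M.cells, (if e ∈ M.facesOf L then M.normal L e i * φ e else 0) =
        if L ∈ ({K, K'} : Finset M.cells) then M.normal L e i * φ e else 0 := fun L => by
      simp [h L]
    simp only [h2]
    rw [Finset.sum_ite_mem, Finset.univ_inter, Finset.sum_pair hne, ← add_mul]
    have h3 := congrArg (fun v : Space d => v i)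
      (M.normal_add_eq_zero hne ((h K).2 (Or.inl rfl)) ((h K').2 (Or.inr rfl)))
    have h4 : M.normal K e i + M.normal K' e i = 0 := h3
    rw [h4, zero_mul]

end PolyMesh

/-! ### Comparison of quadratic forms on polynomial spaces -/

/-- `A / B` is continuous on the compact unit sphere, hence bounded there, and both forms scale
quadratically. -/
theorem exists_form_le {V : Type*} [AddCommGroup V] [Module ℝ V] [FiniteDimensional ℝ V]
    (A B : V →ₗ[ℝ] V →ₗ[ℝ] ℝ) (hB : ∀ v, v ≠ 0 → 0 < B v v) :
    ∃ C : ℝ, 0 < C ∧ ∀ v, A v v ≤ C * B v v := by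
  let b := Module.finBasis ℝ V
  let e := b.equivFun.symm
  have hcont : ∀ D : V →ₗ[ℝ] V →ₗ[ℝ] ℝ, Continuous fun x => D (e x) (e x) := by
    intro D
    have h : ∀ x, D (e x) (e x) = ∑ i, ∑ j, x i * (x j * D (b i) (b j)) := fun x => by
      simp only [e, Module.Basis.equivFun_symm_apply, map_sum, map_smul, LinearMap.sum_apply,
        LinearMap.smul_apply, smul_eq_mul, Finset.mul_sum]
      rw [Finset.sum_comm]
      exact Finset.sum_congr rfl fun i _ => Finset.sum_congr rfl fun j _ => by ring
    simp only [h]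
    fun_prop
  have hpos : ∀ x ∈ Metric.sphere (0 : Fin (Module.finrank ℝ V) → ℝ) 1, 0 < B (e x) (e x) := by
    intro x hx
    refine hB _ fun h => ?_
    have h0 : x = 0 := by simpa using h
    simp [h0] at hx
  obtain ⟨C, hC⟩ := (isCompact_sphere (0 : Fin (Module.finrank ℝ V) → ℝ)
    1).exists_bound_of_continuousOn (f := fun x => A (e x) (e x) / B (e x) (e x))
    ((hcont A).continuousOn.div (hcont B).continuousOn fun x hx => (hpos x hx).ne')
  refine ⟨|C| + 1, by positivity, fun v => ?_⟩
  obtain ⟨x, rfl⟩ := e.surjective v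
  by_cases hx : x = 0
  · simp [hx]
  have hn : 0 < ‖x‖ := norm_pos_iff.2 hx
  have hu : ‖x‖⁻¹ • x ∈ Metric.sphere (0 : Fin (Module.finrank ℝ V) → ℝ) 1 := by
    simp [norm_smul, hn.ne']
  have hBu := hpos _ hu
  have h1 := (le_abs_self _).trans (hC _ hu)
  rw [div_le_iff₀ hBu] at h1
  have h2 : A (e (‖x‖⁻¹ • x)) (e (‖x‖⁻¹ • x)) ≤ (|C| + 1) * B (e (‖x‖⁻¹ • x)) (e (‖x‖⁻¹ • x)) :=
    h1.trans (mul_le_mul_of_nonneg_right (by linarith [le_abs_self C]) hBu.le)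
  simp only [map_smul, LinearMap.smul_apply, smul_eq_mul] at h2
  have h3 : 0 < ‖x‖⁻¹ * ‖x‖⁻¹ := by positivity
  refine le_of_mul_le_mul_left ?_ h3
  linarith

/-- The symmetric form `(p, q) ↦ I (L p * L q)`. -/
def mulForm (I : MvPolynomial (Fin d) ℝ →ₗ[ℝ] ℝ)
    (L : MvPolynomial (Fin d) ℝ →ₗ[ℝ] MvPolynomial (Fin d) ℝ) :
    MvPolynomial (Fin d) ℝ →ₗ[ℝ] MvPolynomial (Fin d) ℝ →ₗ[ℝ] ℝ :=
  ((LinearMap.mul ℝ (MvPolynomial (Fin d) ℝ)).compr₂ I).compl₁₂ L L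

theorem mulForm_apply (I : MvPolynomial (Fin d) ℝ →ₗ[ℝ] ℝ)
    (L : MvPolynomial (Fin d) ℝ →ₗ[ℝ] MvPolynomial (Fin d) ℝ) (p q : MvPolynomial (Fin d) ℝ) :
    mulForm I L p q = I (L p * L q) := rfl

theorem exists_form_le_on {W : Submodule ℝ (MvPolynomial (Fin d) ℝ)} [FiniteDimensional ℝ W]
    (A B : MvPolynomial (Fin d) ℝ →ₗ[ℝ] MvPolynomial (Fin d) ℝ →ₗ[ℝ] ℝ)
    (hB : ∀ p ∈ W, p ≠ 0 → 0 < B p p) :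
    ∃ C : ℝ, 0 < C ∧ ∀ p ∈ W, A p p ≤ C * B p p := by
  obtain ⟨C, hC, h⟩ := exists_form_le (A.domRestrict₁₂ W W) (B.domRestrict₁₂ W W)
    (fun v hv => hB v v.2 fun h => hv (Subtype.ext h))
  exact ⟨C, hC, fun p hp => h ⟨p, hp⟩⟩

/-! ### Operations on polynomials -/

theorem pderiv_mem_polySpace {m : ℕ} {p : MvPolynomial (Fin d) ℝ} (hp : p ∈ PolySpace d m)
    (i : Fin d) : MvPolynomial.pderiv i p ∈ PolySpace d (m - 1) := by
  rw [MvPolynomial.mem_restrictTotalDegree] at hp ⊢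
  refine Finset.sup_le fun s hs => ?_
  rw [MvPolynomial.mem_support_iff, MvPolynomial.coeff_pderiv] at hs
  have h1 := MvPolynomial.le_totalDegree (MvPolynomial.mem_support_iff.2 (left_ne_zero_of_mul hs))
  rw [Finsupp.sum_add_index' (fun _ => rfl) (fun _ _ _ => rfl), Finsupp.sum_single_index rfl] at h1
  omega

theorem C_mem_polySpace (m : ℕ) (a : ℝ) : (MvPolynomial.C a : MvPolynomial (Fin d) ℝ) ∈ PolySpace d m := by
  rw [MvPolynomial.mem_restrictTotalDegree, MvPolynomial.totalDegree_C]
  exact Nat.zero_le _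

theorem polySpace_mono {m m' : ℕ} (h : m ≤ m') : PolySpace d m ≤ PolySpace d m' := fun p hp => by
  rw [MvPolynomial.mem_restrictTotalDegree] at hp ⊢
  exact hp.trans h

/-- The substitution `x ↦ c + h x`. -/
def rescale (c : Space d) (h : ℝ) : MvPolynomial (Fin d) ℝ →ₐ[ℝ] MvPolynomial (Fin d) ℝ :=
  MvPolynomial.aeval fun i => MvPolynomial.C (c i) + MvPolynomial.C h * MvPolynomial.X i

theorem ev_rescale (c : Space d) (h : ℝ) (p : MvPolynomial (Fin d) ℝ) (x : Space d) :
    ev (rescale c h p) x = ev p (c + h • x) := by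
  induction p using MvPolynomial.induction_on with
  | C a => simp [ev, rescale]
  | add p q hp hq => simp only [ev, map_add] at hp hq ⊢; rw [hp, hq]
  | mul_X p i hp =>
    simp only [ev, map_mul] at hp ⊢
    rw [hp]; simp [rescale]

theorem pderiv_rescale (c : Space d) (h : ℝ) (i : Fin d) (p : MvPolynomial (Fin d) ℝ) :
    MvPolynomial.pderiv i (rescale c h p) =
      MvPolynomial.C h * rescale c h (MvPolynomial.pderiv i p) := by
  induction p using MvPolynomial.induction_on with
  | C a => simp [rescale]
  | add p q hp hq => simp only [map_add, hp, hq]; ring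
  | mul_X p j hp =>
    have h1 : MvPolynomial.pderiv i (rescale c h (MvPolynomial.X j)) =
        MvPolynomial.C h * rescale c h (MvPolynomial.pderiv i (MvPolynomial.X j)) := by
      by_cases hij : j = i
      · subst hij; simp [rescale]
      · simp [rescale, MvPolynomial.pderiv_X_of_ne hij]
    rw [map_mul, MvPolynomial.pderiv_mul, hp, h1, MvPolynomial.pderiv_mul, map_add, map_mul, map_mul]
    ring

theorem rescale_mem_polySpace (c : Space d) (h : ℝ) {m : ℕ} {p : MvPolynomial (Fin d) ℝ}
    (hp : p ∈ PolySpace d m) : rescale c h p ∈ PolySpace d m := by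
  rw [MvPolynomial.mem_restrictTotalDegree] at hp ⊢
  rw [rescale, MvPolynomial.aeval_def, MvPolynomial.eval₂_eq]
  refine MvPolynomial.totalDegree_finsetSum_le fun s hs => ?_
  refine (MvPolynomial.totalDegree_mul _ _).trans ?_
  rw [MvPolynomial.algebraMap_eq, MvPolynomial.totalDegree_C, zero_add]
  refine (MvPolynomial.totalDegree_finsetProd _ _).trans ?_
  refine le_trans ?_ ((MvPolynomial.le_totalDegree hs).trans hp)
  refine Finset.sum_le_sum fun i _ => ?_
  refine (MvPolynomial.totalDegree_pow _ _).trans ?_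
  refine (Nat.mul_le_mul_left _ (m := 1) ?_).trans (by simp)
  refine (MvPolynomial.totalDegree_add _ _).trans (max_le (by simp) ?_)
  refine (MvPolynomial.totalDegree_mul _ _).trans (by simp)

theorem eq_zero_of_ev_eq_zero {U : Set (Space d)} (hU : IsOpen U) (hne : U.Nonempty)
    {p : MvPolynomial (Fin d) ℝ} (hz : ∀ x ∈ U, ev p x = 0) : p = 0 := by
  obtain ⟨x, hx⟩ := hne
  have hpre : IsOpen ((WithLp.toLp 2 : (Fin d → ℝ) → Space d) ⁻¹' U) :=
    hU.preimage (by fun_prop)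
  obtain ⟨r, hr, hball⟩ := Metric.isOpen_iff.1 hpre (WithLp.ofLp x) (by simpa using hx)
  refine MvPolynomial.funext_set (fun i => Metric.ball (x i) r) (fun i => ?_) fun y hy => ?_
  · rw [Real.ball_eq_Ioo]
    exact Set.Ioo_infinite (by linarith)
  · rw [← ball_pi _ hr] at hy
    have := hz _ (hball hy)
    simpa [ev] using this

theorem eq_zero_of_pderiv_eq_zero {p : MvPolynomial (Fin d) ℝ}
    (h : ∀ i, MvPolynomial.pderiv i p = 0) (h0 : ev p 0 = 0) : p = 0 := by
  refine eq_zero_of_ev_eq_zero isOpen_univ Set.univ_nonempty fun x _ => ?_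
  have h1 : ∀ s, HasDerivAt (fun s : ℝ => ev p (0 + s • x)) 0 s := fun s => by
    have := hasDerivAt_ev_line p 0 x s
    simpa [h, ev] using this
  have h2 := is_const_of_deriv_eq_zero (fun s => (h1 s).differentiableAt)
    (fun s => (h1 s).deriv) 1 0
  simpa [h0] using h2

/-! ### Inverse and Poincaré inequalities on cells comparable to a ball -/

theorem integrableOn_ev_of_bounded {S : Set (Space d)} (hS : Bornology.IsBounded S)
    (p : MvPolynomial (Fin d) ℝ) : IntegrableOn (ev p) S volume :=
  integrable_ev hS.isCompact_closure hS.measure_lt_top p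

theorem cellInt_mono_set {S S' : Set (Space d)} (hS' : Bornology.IsBounded S') (h : S ⊆ S')
    {p : MvPolynomial (Fin d) ℝ} (hp : ∀ x, 0 ≤ ev p x) :
    cellInt S p ≤ cellInt S' p :=
  setIntegral_mono_set (integrableOn_ev_of_bounded hS' p)
    (Eventually.of_forall hp) h.eventuallyLE

theorem cellInt_nonneg {S : Set (Space d)} {p : MvPolynomial (Fin d) ℝ} (hp : ∀ x, 0 ≤ ev p x) :
    0 ≤ cellInt S p := integral_nonneg hp

theorem ev_mul_self_nonneg (p : MvPolynomial (Fin d) ℝ) (x : Space d) : 0 ≤ ev (p * p) x := by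
  simp [ev, mul_self_nonneg]

theorem cellInt_rescale {h : ℝ} (hh : 0 < h) (c : Space d) {S : Set (Space d)}
    (hS : MeasurableSet S) (p : MvPolynomial (Fin d) ℝ) :
    cellInt S p = h ^ d * cellInt ((fun x => c + h • x) ⁻¹' S) (rescale c h p) := by
  have hm : Measurable fun x : Space d => c + h • x := by fun_prop
  have h1 : cellInt ((fun x => c + h • x) ⁻¹' S) (rescale c h p) =
      ∫ x, (fun y => S.indicator (ev p) (c + y)) (h • x) := by
    unfold cellInt
    rw [← integral_indicator (hm hS)]
    refine integral_congr_ae (Eventually.of_forall fun x => ?_)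
    simp only [Set.indicator_apply, Set.mem_preimage, ev_rescale]
  rw [h1, Measure.integral_comp_smul volume (fun y => S.indicator (ev p) (c + y)) h,
    integral_add_left_eq_self (S.indicator (ev p)) c,
    integral_indicator hS, finrank_euclideanSpace_fin, abs_of_pos (by positivity), smul_eq_mul,
    mul_inv_cancel_left₀ (by positivity)]
  rfl

theorem cellInt_ball_rescale {h : ℝ} (hh : 0 < h) (c : Space d) (θ : ℝ)
    (p : MvPolynomial (Fin d) ℝ) :
    cellInt (Metric.ball c (θ * h)) p = h ^ d * cellInt (Metric.ball 0 θ) (rescale c h p) := by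
  rw [cellInt_rescale hh c measurableSet_ball]
  congr 2
  ext x
  simp [norm_smul, abs_of_pos hh, mul_comm h, hh]

theorem cellInt_closedBall_rescale {h : ℝ} (hh : 0 < h) (c : Space d)
    (p : MvPolynomial (Fin d) ℝ) :
    cellInt (Metric.closedBall c h) p = h ^ d * cellInt (Metric.closedBall 0 1) (rescale c h p) := by
  rw [cellInt_rescale hh c Metric.isClosed_closedBall.measurableSet]
  congr 2
  ext x
  simp [norm_smul, abs_of_pos hh, hh]

theorem cellInt_ball_pos {r : ℝ} (hr : 0 < r) {p : MvPolynomial (Fin d) ℝ} (hp : p ≠ 0) :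
    0 < cellInt (Metric.ball 0 r) (p * p) := by
  refine (cellInt_nonneg (ev_mul_self_nonneg p)).lt_of_ne fun h => hp ?_
  have hae := ae_zero_of_int_sq (integrableOn_ev_of_bounded Metric.isBounded_ball) h.symm
  exact eq_zero_of_ev_eq_zero Metric.isOpen_ball ⟨0, Metric.mem_ball_self hr⟩
    (Measure.eqOn_open_of_ae_eq (f := ev p) (g := fun _ => (0 : ℝ)) hae Metric.isOpen_ball
      (continuous_ev p).continuousOn continuousOn_const)

/-- After rescaling, the gradient over the unit ball is compared with the function over the ball of
radius `θ`. As `K` lies between the two balls, both sides pass to `K` with a constant that sees only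
`d`, `k` and `θ`. -/
theorem exists_inverse_constant (d k : ℕ) {θ : ℝ} (hθ : 0 < θ) :
    ∃ C : ℝ, 0 < C ∧ ∀ p ∈ PolySpace d k, ∀ (c : Space d) (h : ℝ), 0 < h →
      ∀ K : Set (Space d), Metric.ball c (θ * h) ⊆ K → K ⊆ Metric.closedBall c h →
      h ^ 2 * ∑ i, cellInt K (MvPolynomial.pderiv i p * MvPolynomial.pderiv i p) ≤
        C * cellInt K (p * p) := by
  let I1 := intFunctional volume (Metric.closedBall (0 : Space d) 1)
    (integrableOn_ev_of_bounded Metric.isBounded_closedBall)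
  let I2 := intFunctional volume (Metric.ball (0 : Space d) θ)
    (integrableOn_ev_of_bounded Metric.isBounded_ball)
  obtain ⟨C, hC, hle⟩ := exists_form_le_on (W := PolySpace d k)
    (∑ i, mulForm I1 (MvPolynomial.pderiv i).toLinearMap) (mulForm I2 LinearMap.id)
    (fun p _ hp => cellInt_ball_pos hθ hp)
  refine ⟨C, hC, fun p hp c h hh K hbK hKb => ?_⟩
  have h1 := hle _ (rescale_mem_polySpace c h hp)
  simp only [LinearMap.sum_apply, mulForm_apply, LinearMap.id_apply, ← map_mul] at h1
  have h2 : ∀ i, I1 ((MvPolynomial.pderiv i).toLinearMap (rescale c h p) *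
      (MvPolynomial.pderiv i).toLinearMap (rescale c h p)) =
      h ^ 2 * cellInt (Metric.closedBall 0 1)
        (rescale c h (MvPolynomial.pderiv i p * MvPolynomial.pderiv i p)) := by
    intro i
    change I1 (MvPolynomial.pderiv i (rescale c h p) * MvPolynomial.pderiv i (rescale c h p)) =
      h ^ 2 * I1 _
    rw [pderiv_rescale, ← smul_eq_mul (h ^ 2), ← map_smul, MvPolynomial.smul_eq_C_mul]
    congr 1
    simp only [map_mul, map_pow]
    ring
  simp only [h2, ← Finset.mul_sum] at h1
  have h3 : C * cellInt (Metric.ball c (θ * h)) (p * p) ≤ C * cellInt K (p * p) :=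
    mul_le_mul_of_nonneg_left (cellInt_mono_set (Metric.isBounded_closedBall.subset hKb) hbK
      (ev_mul_self_nonneg p)) hC.le
  refine le_trans ?_ h3
  rw [cellInt_ball_rescale hh]
  have h4 : ∑ i, cellInt K (MvPolynomial.pderiv i p * MvPolynomial.pderiv i p) ≤
      ∑ i, h ^ d * cellInt (Metric.closedBall 0 1)
        (rescale c h (MvPolynomial.pderiv i p * MvPolynomial.pderiv i p)) := by
    refine Finset.sum_le_sum fun i _ => ?_
    rw [← cellInt_closedBall_rescale hh]
    exact cellInt_mono_set Metric.isBounded_closedBall hKb (ev_mul_self_nonneg _)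
  rw [← Finset.mul_sum] at h4
  have h5 := mul_le_mul_of_nonneg_left h1 (pow_pos hh d).le
  have h6 := mul_le_mul_of_nonneg_left h4 (sq_nonneg h)
  have h7 : I2 (rescale c h (p * p)) = cellInt (Metric.ball 0 θ) (rescale c h (p * p)) := rfl
  rw [h7] at h5
  nlinarith

/-- Here the larger ball carries the function and the smaller one the gradient. Subtracting the
value at `c`, not a mean, makes the constant to be removed independent of `K`. -/
theorem exists_poincare_constant (d k : ℕ) {θ : ℝ} (hθ : 0 < θ) :
    ∃ C : ℝ, 0 < C ∧ ∀ p ∈ PolySpace d k, ∀ (c : Space d) (h : ℝ), 0 < h →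
      ∀ K : Set (Space d), Metric.ball c (θ * h) ⊆ K → K ⊆ Metric.closedBall c h →
      cellInt K ((p - MvPolynomial.C (ev p c)) * (p - MvPolynomial.C (ev p c))) ≤
        C * h ^ 2 * ∑ i, cellInt K (MvPolynomial.pderiv i p * MvPolynomial.pderiv i p) := by
  let I1 := intFunctional volume (Metric.closedBall (0 : Space d) 1)
    (integrableOn_ev_of_bounded Metric.isBounded_closedBall)
  let I2 := intFunctional volume (Metric.ball (0 : Space d) θ)
    (integrableOn_ev_of_bounded Metric.isBounded_ball)
  -- On polynomials vanishing at the origin the gradient seminorm is definite, which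
  -- `exists_form_le_on` needs.
  let W : Submodule ℝ (MvPolynomial (Fin d) ℝ) := PolySpace d k ⊓
    LinearMap.ker (MvPolynomial.aeval (R := ℝ) (fun _ : Fin d => (0 : ℝ))).toLinearMap
  have hW : ∀ p, p ∈ W ↔ p ∈ PolySpace d k ∧ ev p 0 = 0 := fun p => by
    simp only [W, Submodule.mem_inf, LinearMap.mem_ker, AlgHom.toLinearMap_apply, ev]
    rfl
  have : FiniteDimensional ℝ W := Submodule.finiteDimensional_of_le (inf_le_left)
  obtain ⟨C, hC, hle⟩ := exists_form_le_on (W := W) (mulForm I1 LinearMap.id)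
    (∑ i, mulForm I2 (MvPolynomial.pderiv i).toLinearMap) (fun p hpW hp => by
      simp only [LinearMap.sum_apply, mulForm_apply]
      have hnn : ∀ i, 0 ≤ I2 ((MvPolynomial.pderiv i).toLinearMap p *
          (MvPolynomial.pderiv i).toLinearMap p) :=
        fun i => cellInt_nonneg (ev_mul_self_nonneg (MvPolynomial.pderiv i p))
      refine (Finset.sum_nonneg fun i _ => hnn i).lt_of_ne fun h => hp ?_
      refine eq_zero_of_pderiv_eq_zero (fun i => ?_) ((hW p).1 hpW).2
      by_contra hne
      have h1 := (Finset.sum_eq_zero_iff_of_nonneg fun i _ => hnn i).1 h.symm i (Finset.mem_univ i)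
      exact (cellInt_ball_pos hθ hne).ne' h1)
  refine ⟨C, hC, fun p hp c h hh K hbK hKb => ?_⟩
  set q := p - MvPolynomial.C (ev p c) with hq
  have hqd : ∀ i, MvPolynomial.pderiv i p = MvPolynomial.pderiv i q := fun i => by simp [hq]
  have hqm : q ∈ PolySpace d k := Submodule.sub_mem _ hp (C_mem_polySpace k _)
  have hqc : ev q c = 0 := by simp [hq, ev]
  simp only [hqd]
  have h1 := hle _ ((hW _).2 ⟨rescale_mem_polySpace c h hqm, by rw [ev_rescale]; simpa using hqc⟩)
  simp only [LinearMap.sum_apply, mulForm_apply, LinearMap.id_apply, ← map_mul] at h1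
  have h2 : ∀ i, I2 ((MvPolynomial.pderiv i).toLinearMap (rescale c h q) *
      (MvPolynomial.pderiv i).toLinearMap (rescale c h q)) =
      h ^ 2 * cellInt (Metric.ball 0 θ)
        (rescale c h (MvPolynomial.pderiv i q * MvPolynomial.pderiv i q)) := by
    intro i
    change I2 (MvPolynomial.pderiv i (rescale c h q) * MvPolynomial.pderiv i (rescale c h q)) =
      h ^ 2 * I2 _
    rw [pderiv_rescale, ← smul_eq_mul (h ^ 2), ← map_smul, MvPolynomial.smul_eq_C_mul]
    congr 1
    simp only [map_mul, map_pow]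
    ring
  simp only [h2, ← Finset.mul_sum] at h1
  have h3 : cellInt K (q * q) ≤ cellInt (Metric.closedBall c h) (q * q) :=
    cellInt_mono_set Metric.isBounded_closedBall hKb (ev_mul_self_nonneg _)
  refine h3.trans ?_
  rw [cellInt_closedBall_rescale hh]
  have h4 : ∑ i, h ^ d * cellInt (Metric.ball 0 θ)
        (rescale c h (MvPolynomial.pderiv i q * MvPolynomial.pderiv i q)) ≤
      ∑ i, cellInt K (MvPolynomial.pderiv i q * MvPolynomial.pderiv i q) := by
    refine Finset.sum_le_sum fun i _ => ?_
    rw [← cellInt_ball_rescale hh]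
    exact cellInt_mono_set (Metric.isBounded_closedBall.subset hKb) hbK
      (ev_mul_self_nonneg _)
  rw [← Finset.mul_sum] at h4
  have h5 := mul_le_mul_of_nonneg_left h1 (pow_pos hh d).le
  have h6 := mul_le_mul_of_nonneg_left h4 (mul_pos hC (pow_pos hh 2)).le
  have h7 : I1 (rescale c h (q * q)) = cellInt (Metric.closedBall 0 1) (rescale c h (q * q)) := rfl
  rw [h7] at h5
  linarith

/-- Boundedness provides an enclosing ball; without one the infimum defining `cellSize` would take
its default value `0`. -/
theorem dist_le_cellSize {K : Set (Space d)} (hb : Bornology.IsBounded K) {x y : Space d}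
    (hx : x ∈ K) (hy : y ∈ K) : dist x y ≤ cellSize K := by
  refine le_csInf ?_ ?_
  · obtain ⟨R, hR⟩ := hb.subset_closedBall 0
    exact ⟨2 * R, 0, by simpa using hR⟩
  · rintro δ ⟨c, hc⟩
    have h1 := Metric.mem_closedBall.1 (hc hx)
    have h2 := Metric.mem_closedBall'.1 (hc hy)
    linarith [dist_triangle x c y]

theorem cellSize_pos (hd : 0 < d) {K : Set (Space d)} (hb : Bornology.IsBounded K) (ho : IsOpen K)
    (hne : K.Nonempty) : 0 < cellSize K := by
  obtain ⟨x, hx⟩ := hne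
  obtain ⟨r, hr, hball⟩ := Metric.isOpen_iff.1 ho x hx
  have h1 : x + (r / 2) • EuclideanSpace.single ⟨0, hd⟩ (1 : ℝ) ∈ K := by
    refine hball ?_
    rw [mem_ball_iff_norm, add_sub_cancel_left, norm_smul, Real.norm_of_nonneg (by linarith)]
    simp [hr]
  refine lt_of_lt_of_le ?_ (dist_le_cellSize hb h1 hx)
  rw [dist_eq_norm, add_sub_cancel_left, norm_smul, Real.norm_of_nonneg (by linarith)]
  simp [hr]

theorem cellSize_le {K : Set (Space d)} (hne : K.Nonempty) {R : ℝ}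
    (hR : K ⊆ Metric.closedBall 0 R) : cellSize K ≤ 2 * R := by
  refine csInf_le ⟨0, ?_⟩ ⟨0, by simpa using hR⟩
  rintro δ ⟨c, hc⟩
  obtain ⟨x, hx⟩ := hne
  have := dist_nonneg.trans (Metric.mem_closedBall.1 (hc hx))
  linarith

theorem faceInt_nonneg {S : Set (Space d)} {p : MvPolynomial (Fin d) ℝ} (hp : ∀ x, 0 ≤ ev p x) :
    0 ≤ faceInt S p := integral_nonneg hp

theorem abs_coord_le_norm (x : Space d) (i : Fin d) : |x i| ≤ ‖x‖ := by
  simpa using EuclideanSpace.norm_eq x ▸ PiLp.norm_apply_le x i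

theorem mul_le_weighted_sq {a b lam : ℝ} (hl : 0 < lam) :
    a * b ≤ lam * (a * a) + 1 / (4 * lam) * (b * b) := by
  have h : lam * (a * a) + 1 / (4 * lam) * (b * b) - a * b =
      1 / (4 * lam) * ((2 * lam * a - b) * (2 * lam * a - b)) := by field_simp; ring
  have : 0 ≤ 1 / (4 * lam) * ((2 * lam * a - b) * (2 * lam * a - b)) :=
    mul_nonneg (by positivity) (mul_self_nonneg _)
  linarith

/-! ### Trace inequality, and control of the broken gradient and the trace jumps by the energy. -/

namespace PolyMesh

variable {Ω : Set (Space d)} (M : PolyMesh Ω)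

theorem cellInt_mono (K : M.cells) {p q : MvPolynomial (Fin d) ℝ}
    (h : ∀ x ∈ (K : Set (Space d)), ev p x ≤ ev q x) : cellInt K.1 p ≤ cellInt K.1 q :=
  setIntegral_mono_on (M.integrableOn_cell K p) (M.integrableOn_cell K q)
    (M.cell_polyhedron K K.2).isOpen.measurableSet h

theorem faceInt_mono (e : M.faces) {p q : MvPolynomial (Fin d) ℝ}
    (h : ∀ x ∈ (e : Set (Space d)), ev p x ≤ ev q x) : faceInt e.1 p ≤ faceInt e.1 q :=
  setIntegral_mono_on (M.integrableOn_face e p) (M.integrableOn_face e q)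
    (M.face_flat e e.2).measurableSet h

/-- `h_K`. -/
def size (K : M.cells) : ℝ := cellSize (K : Set (Space d))

/-- The cell `K` is star-shaped with respect to the ball of radius `θ h_K` around `c`. -/
def IsStarCenter (θ : ℝ) (K : M.cells) (c : Space d) : Prop :=
  c ∈ (K : Set (Space d)) ∧
    ∀ y ∈ Metric.ball c (θ * M.size K), StarConvex ℝ y (K : Set (Space d))

variable {M}

theorem size_pos (hd : 0 < d) (K : M.cells) : 0 < M.size K :=
  have hK := M.cell_polyhedron K K.2
  cellSize_pos hd (M.cell_bounded K) hK.isOpen hK.isConnected.nonempty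

theorem IsStarCenter.ball_subset {θ : ℝ} {K : M.cells} {c : Space d} (h : M.IsStarCenter θ K c) :
    Metric.ball c (θ * M.size K) ⊆ K := fun y hy => by
  have h1 := (h.2 y hy) h.1 (zero_le_one' ℝ) (le_refl (0 : ℝ)) (add_zero 1)
  simpa using h1

theorem IsStarCenter.subset_closedBall {θ : ℝ} {K : M.cells} {c : Space d}
    (h : M.IsStarCenter θ K c) : (K : Set (Space d)) ⊆ Metric.closedBall c (M.size K) :=
  fun _ hy => Metric.mem_closedBall.2 (dist_le_cellSize (M.cell_bounded K) hy h.1)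

/-- Apply `cellInt_radialDiv` to `p²`. Each offset is at least `θ h_K`, and `|x - c| ≤ h_K` bounds
the integrand by `2d p² + h_K² |∇p|²`; the inverse inequality removes the gradient, whence `(2d + C)
/ θ`. -/
theorem exists_trace_constant (hd : 0 < d) (k : ℕ) {θ : ℝ} (hθ : 0 < θ) :
    ∃ C : ℝ, 0 < C ∧ ∀ {Ω : Set (Space d)} (M : PolyMesh Ω) (K : M.cells) (c : Space d),
      M.IsStarCenter θ K c → ∀ p ∈ PolySpace d k,
      M.size K * ∑ e ∈ M.facesOf K, faceInt e.1 (p * p) ≤ C * cellInt K.1 (p * p) := by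
  obtain ⟨C, hC, hinv⟩ := exists_inverse_constant d k hθ
  refine ⟨(2 * d + C) / θ, by positivity, fun M K c hc p hp => ?_⟩
  have hh := size_pos hd K
  have h1 := cellInt_radialDiv hd K (mul_pos hθ hh) hc.2 (p * p)
  have h2 : ∑ e ∈ M.facesOf K, θ * M.size K * faceInt e.1 (p * p) ≤
      ∑ e ∈ M.facesOf K, M.offset K e c * faceInt e.1 (p * p) :=
    Finset.sum_le_sum fun e he => mul_le_mul_of_nonneg_right
      (M.le_offset he (mul_pos hθ hh) hc.2) (faceInt_nonneg (ev_mul_self_nonneg p))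
  have h3 : cellInt K.1 (radialDiv c (p * p)) ≤
      cellInt K.1 (MvPolynomial.C (2 * (d : ℝ)) * (p * p) + MvPolynomial.C (M.size K ^ 2) *
        ∑ i, MvPolynomial.pderiv i p * MvPolynomial.pderiv i p) := by
    refine M.cellInt_mono K fun x hx => ?_
    have h4 : ∀ i, (x i - c i) * (2 * ev p x * ev (MvPolynomial.pderiv i p) x) ≤
        ev p x * ev p x + M.size K ^ 2 *
          (ev (MvPolynomial.pderiv i p) x * ev (MvPolynomial.pderiv i p) x) := fun i => by
      have h5 : |x i - c i| ≤ M.size K :=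
        (abs_coord_le_norm (x - c) i).trans (mem_closedBall_iff_norm.1 (hc.subset_closedBall hx))
      have h6 : (x i - c i) ^ 2 ≤ M.size K ^ 2 := sq_le_sq' (neg_le_of_abs_le h5) (le_of_abs_le h5)
      have h7 := mul_le_mul_of_nonneg_right h6 (sq_nonneg (ev (MvPolynomial.pderiv i p) x))
      nlinarith [sq_nonneg (ev p x - (x i - c i) * ev (MvPolynomial.pderiv i p) x)]
    have h8 := Finset.sum_le_sum fun i (_ : i ∈ Finset.univ) => h4 i
    simp only [Finset.sum_add_distrib, Finset.sum_const, Finset.card_univ, Fintype.card_fin,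
      nsmul_eq_mul] at h8
    rw [← Finset.mul_sum] at h8
    have h9 : ev (radialDiv c (p * p)) x = d * (ev p x * ev p x) +
        ∑ i, (x i - c i) * (2 * ev p x * ev (MvPolynomial.pderiv i p) x) := by
      simp only [ev, radialDiv, MvPolynomial.pderiv_mul, map_add, map_mul, map_sum, map_sub,
        MvPolynomial.eval_C, MvPolynomial.eval_X]
      congr 1
      exact Finset.sum_congr rfl fun i _ => by ring
    rw [h9]
    simp only [ev, map_add, map_mul, map_sum, MvPolynomial.eval_C] at h8 ⊢
    linarith
  have h10 := hinv p hp c _ hh K hc.ball_subset hc.subset_closedBall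
  rw [M.cellInt_eq, M.cellInt_eq, map_add, ← MvPolynomial.smul_eq_C_mul,
    ← MvPolynomial.smul_eq_C_mul, map_smul, map_smul, map_sum] at h3
  simp only [smul_eq_mul, ← M.cellInt_eq] at h3
  rw [← Finset.mul_sum, mul_assoc] at h2
  rw [div_mul_eq_mul_div, le_div_iff₀ hθ]
  linarith

/-- Best approximation by the `L²`-projection, tested against constants, which belong to `P_l` for
every `l`. -/
theorem faceProj_error_le {l : ℕ} (e : M.faces) (w : MvPolynomial (Fin d) ℝ) (a : ℝ) :
    faceInt e.1 ((w - (M.faceProj l e w).1) * (w - (M.faceProj l e w).1)) ≤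
      faceInt e.1 ((w - MvPolynomial.C a) * (w - MvPolynomial.C a)) := by
  set P := (M.faceProj l e w).1 with hP
  have h1 := M.faceProj_spec l e w
    (M.faceProj l e w - ⟨MvPolynomial.C a, C_mem_polySpace l a⟩)
  have h2 : (w - MvPolynomial.C a) * (w - MvPolynomial.C a) = (w - P) * (w - P) +
      (P - MvPolynomial.C a) * (P - MvPolynomial.C a) + (2 : ℝ) •
      (w * (P - MvPolynomial.C a) - P * (P - MvPolynomial.C a)) := by
    rw [two_smul]; ring
  have h3 : faceInt e.1 (P * (P - MvPolynomial.C a)) = faceInt e.1 (w * (P - MvPolynomial.C a)) := h1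
  have h4 : 0 ≤ faceInt e.1 ((P - MvPolynomial.C a) * (P - MvPolynomial.C a)) :=
    faceInt_nonneg (ev_mul_self_nonneg _)
  rw [h2]
  simp only [M.faceInt_eq_functional, map_add, map_smul, map_sub] at h3 h4 ⊢
  rw [h3]
  simp only [sub_self, smul_zero]
  linarith

/-- `∫_K |∇w|²`. -/
def gradSq {k : ℕ} (w : M.V k) (K : M.cells) : ℝ :=
  ∑ i, cellInt K.1 (MvPolynomial.pderiv i (w K).1 * MvPolynomial.pderiv i (w K).1)

theorem jump_self_nonneg {k l : ℕ} (w : M.V k) (μ : M.Vhat l) (hd : 0 < d) :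
    0 ≤ M.jump w μ w μ :=
  Finset.sum_nonneg fun K _ => Finset.sum_nonneg fun _ _ =>
    mul_nonneg (inv_nonneg.2 (size_pos hd K).le) (faceInt_nonneg (ev_mul_self_nonneg _))

theorem innerQ_self_nonneg {k : ℕ} (r : M.Q k) : 0 ≤ M.innerQ r r :=
  Finset.sum_nonneg fun _ _ => Finset.sum_nonneg fun _ _ => cellInt_nonneg (ev_mul_self_nonneg _)

/-- The piecewise gradient. -/
def brokenGrad {k : ℕ} (w : M.V k) : M.Q k := fun K i =>
  ⟨MvPolynomial.pderiv i (w K).1, pderiv_mem_polySpace (w K).2 i⟩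

/-- The normal derivative of `w|_K` on the face `e`. -/
def normalDeriv {k : ℕ} (w : M.V k) (K : M.cells) (e : M.faces) : MvPolynomial (Fin d) ℝ :=
  ∑ i, MvPolynomial.C (M.normal K e i) * MvPolynomial.pderiv i (w K).1

theorem normalDeriv_mem {k : ℕ} (w : M.V k) (K : M.cells) (e : M.faces) :
    normalDeriv w K e ∈ PolySpace d (k - 1) := by
  refine Submodule.sum_mem _ fun i _ => ?_
  rw [← MvPolynomial.smul_eq_C_mul]
  exact Submodule.smul_mem _ _ (pderiv_mem_polySpace (w K).2 i)

theorem normalDeriv_sq_le {k : ℕ} (w : M.V k) {K : M.cells} {e : M.faces} (he : e ∈ M.facesOf K)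
    (x : Space d) : ev (normalDeriv w K e * normalDeriv w K e) x ≤
      ev (∑ i, MvPolynomial.pderiv i (w K).1 * MvPolynomial.pderiv i (w K).1) x := by
  have h1 := Finset.sum_mul_sq_le_sq_mul_sq Finset.univ (fun i => M.normal K e i)
    (fun i => ev (MvPolynomial.pderiv i (w K).1) x)
  have h2 : ∑ i, (M.normal K e i) ^ 2 = 1 := by
    have := EuclideanSpace.real_norm_sq_eq (M.normal K e)
    rw [← this, M.norm_normal he]; norm_num
  rw [h2, one_mul] at h1
  simp only [ev, normalDeriv, map_mul, map_sum, MvPolynomial.eval_C, sq] at h1 ⊢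
  exact h1

/-- Integration by parts on each cell. The trace of `w` may be replaced by its projection because
the normal derivative has degree at most `k - 1 ≤ l` and is an admissible test function for
`faceProj_spec`. -/
theorem innerQ_discreteGrad_brokenGrad {k l : ℕ} (hl : k - 1 ≤ l) {θ : ℝ} (hθ : 0 < θ) (hd : 0 < d)
    (hstar : ∀ K : M.cells, ∃ c, M.IsStarCenter θ K c) (w : M.V k) (μ : M.Vhat l) :
    M.innerQ (M.discreteGrad w μ) (brokenGrad w) = ∑ K : M.cells, (gradSq w K -
      ∑ e ∈ M.facesOf K, faceInt e.1 (((M.faceProj l e (w K).1).1 - (μ.1 e).1) *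
        normalDeriv w K e)) := by
  rw [M.discreteGrad_spec, ← Finset.sum_neg_distrib, ← Finset.sum_add_distrib]
  refine Finset.sum_congr rfl fun K _ => ?_
  obtain ⟨c, hc⟩ := hstar K
  have hdiv := fun i => cellInt_pderiv K (mul_pos hθ (size_pos hd K)) hc.2 i
    ((w K).1 * MvPolynomial.pderiv i (w K).1)
  have h1 : cellInt K.1 ((w K).1 * ∑ i, MvPolynomial.pderiv i (brokenGrad w K i).1) + gradSq w K =
      ∑ e ∈ M.facesOf K, faceInt e.1 ((w K).1 * normalDeriv w K e) := by
    have h2 : ∀ e : M.faces, faceInt e.1 ((w K).1 * normalDeriv w K e) =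
        ∑ i, M.normal K e i * faceInt e.1 ((w K).1 * MvPolynomial.pderiv i (w K).1) := fun e => by
      rw [normalDeriv, Finset.mul_sum, M.faceInt_eq_functional, map_sum]
      refine Finset.sum_congr rfl fun i _ => ?_
      rw [mul_left_comm, ← MvPolynomial.smul_eq_C_mul, map_smul]
      rfl
    simp only [h2]
    rw [Finset.sum_comm]
    simp only [← hdiv]
    rw [gradSq, Finset.mul_sum, M.cellInt_eq, map_sum, ← Finset.sum_add_distrib]
    refine Finset.sum_congr rfl fun i _ => ?_
    rw [M.cellInt_eq, M.cellInt_eq, ← map_add, MvPolynomial.pderiv_mul, add_comm]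
    rfl
  have h3 : ∀ e : M.faces, faceInt e.1 (((M.faceProj l e (w K).1).1 - (μ.1 e).1) *
      normalDeriv w K e) = faceInt e.1 ((w K).1 * normalDeriv w K e) -
        faceInt e.1 ((μ.1 e).1 * normalDeriv w K e) := fun e => by
    have h4 := M.faceProj_spec l e (w K).1
      ⟨normalDeriv w K e, polySpace_mono hl (normalDeriv_mem w K e)⟩
    rw [← h4, sub_mul]
    simp only [M.faceInt_eq_functional, map_sub]
  simp only [h3, Finset.sum_sub_distrib, ← h1]
  change _ + ∑ e ∈ M.facesOf K, faceInt e.1 ((μ.1 e).1 * normalDeriv w K e) = _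
  ring

/-- In the preceding identity Young's inequality leaves a quarter of `Σ ‖∇w‖²` from the cell term
and another quarter from the face term. Absorbing both gives the factor `2`. -/
theorem sum_gradSq_le {k l : ℕ} (hl : k - 1 ≤ l) {θ Ct : ℝ} (hθ : 0 < θ) (hd : 0 < d) (hCt : 0 < Ct)
    (hstar : ∀ K : M.cells, ∃ c, M.IsStarCenter θ K c)
    (htrace : ∀ K : M.cells, ∀ p ∈ PolySpace d k,
      M.size K * ∑ e ∈ M.facesOf K, faceInt e.1 (p * p) ≤ Ct * cellInt K.1 (p * p))
    (w : M.V k) (μ : M.Vhat l) :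
    ∑ K : M.cells, gradSq w K ≤
      2 * M.innerQ (M.discreteGrad w μ) (M.discreteGrad w μ) + 2 * Ct * M.jump w μ w μ := by
  have h1 := innerQ_discreteGrad_brokenGrad hl hθ hd hstar w μ
  rw [Finset.sum_sub_distrib] at h1
  set κ := M.discreteGrad w μ
  have h2 : M.innerQ κ (brokenGrad w) ≤ M.innerQ κ κ + 1 / 4 * ∑ K : M.cells, gradSq w K := by
    simp only [innerQ, gradSq, Finset.mul_sum, ← Finset.sum_add_distrib]
    refine Finset.sum_le_sum fun K _ => Finset.sum_le_sum fun i _ => ?_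
    have h3 : cellInt K.1 ((κ K i).1 * (brokenGrad w K i).1) ≤
        cellInt K.1 ((κ K i).1 * (κ K i).1 + MvPolynomial.C (1 / 4) *
          ((brokenGrad w K i).1 * (brokenGrad w K i).1)) := by
      refine M.cellInt_mono K fun x _ => ?_
      have h4 := mul_le_weighted_sq (a := ev (κ K i).1 x) (b := ev (brokenGrad w K i).1 x) one_pos
      simp only [ev, map_add, map_mul, MvPolynomial.eval_C] at h4 ⊢
      linarith
    refine h3.trans_eq ?_
    rw [M.cellInt_eq, map_add, ← MvPolynomial.smul_eq_C_mul, map_smul]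
    rfl
  have h5 : ∀ K : M.cells, ∑ e ∈ M.facesOf K, faceInt e.1
      (((M.faceProj l e (w K).1).1 - (μ.1 e).1) * normalDeriv w K e) ≤
      Ct * (∑ e ∈ M.facesOf K, (cellSize K.1)⁻¹ * faceInt e.1
        (((M.faceProj l e (w K).1).1 - (μ.1 e).1) * ((M.faceProj l e (w K).1).1 - (μ.1 e).1))) +
      1 / 4 * gradSq w K := by
    intro K
    have hh := size_pos hd K
    have h6 : ∀ e ∈ M.facesOf K, faceInt e.1
        (((M.faceProj l e (w K).1).1 - (μ.1 e).1) * normalDeriv w K e) ≤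
        Ct * ((cellSize K.1)⁻¹ * faceInt e.1 (((M.faceProj l e (w K).1).1 - (μ.1 e).1) *
          ((M.faceProj l e (w K).1).1 - (μ.1 e).1))) +
        M.size K / (4 * Ct) * ∑ i, faceInt e.1
          (MvPolynomial.pderiv i (w K).1 * MvPolynomial.pderiv i (w K).1) := by
      intro e he
      set z := (M.faceProj l e (w K).1).1 - (μ.1 e).1
      have h7 : faceInt e.1 (z * normalDeriv w K e) ≤ faceInt e.1
          (MvPolynomial.C (Ct * (M.size K)⁻¹) * (z * z) + MvPolynomial.C (M.size K / (4 * Ct)) *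
            ∑ i, MvPolynomial.pderiv i (w K).1 * MvPolynomial.pderiv i (w K).1) := by
        refine M.faceInt_mono e fun x _ => ?_
        -- The weight `Ct / h_K` leaves `h_K / (4 Ct)` on the normal derivative, which the trace
        -- inequality turns into exactly `1/4`.
        have h8 := mul_le_weighted_sq (a := ev z x) (b := ev (normalDeriv w K e) x)
          (mul_pos hCt (inv_pos.2 hh))
        have h9 := mul_le_mul_of_nonneg_left (normalDeriv_sq_le w he x)
          (by positivity : 0 ≤ M.size K / (4 * Ct))
        have h10 : 1 / (4 * (Ct * (M.size K)⁻¹)) = M.size K / (4 * Ct) := by field_simp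
        rw [h10] at h8
        simp only [ev, map_add, map_mul, MvPolynomial.eval_C] at h8 h9 ⊢
        linarith
      refine h7.trans_eq ?_
      rw [M.faceInt_eq_functional, map_add, ← MvPolynomial.smul_eq_C_mul,
        ← MvPolynomial.smul_eq_C_mul, map_smul, map_smul, map_sum, smul_eq_mul, smul_eq_mul,
        mul_assoc]
      rfl
    refine (Finset.sum_le_sum h6).trans ?_
    rw [Finset.sum_add_distrib, ← Finset.mul_sum, ← Finset.mul_sum]
    refine add_le_add_right ?_ _
    rw [← Finset.mul_sum, Finset.sum_comm, gradSq, Finset.mul_sum, Finset.mul_sum]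
    refine Finset.sum_le_sum fun i _ => ?_
    have h11 := htrace K _ (polySpace_mono (Nat.sub_le k 1) (pderiv_mem_polySpace (w K).2 i))
    rw [div_mul_eq_mul_div, div_le_iff₀ (by positivity)]
    linarith
  have h12 := Finset.sum_le_sum fun K (_ : K ∈ Finset.univ) => h5 K
  rw [Finset.sum_add_distrib, ← Finset.mul_sum, ← Finset.mul_sum] at h12
  have h13 : M.jump w μ w μ = ∑ K : M.cells, ∑ e ∈ M.facesOf K, (cellSize K.1)⁻¹ * faceInt e.1
        (((M.faceProj l e (w K).1).1 - (μ.1 e).1) * ((M.faceProj l e (w K).1).1 - (μ.1 e).1)) := rfl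
  rw [← h13] at h12
  linarith

/-- `h_K⁻¹ ‖w - μ‖²` on `∂K`. -/
def traceJump {k l : ℕ} (w : M.V k) (μ : M.Vhat l) (K : M.cells) : ℝ :=
  ∑ e ∈ M.facesOf K, (M.size K)⁻¹ * faceInt e.1
    (((w K).1 - (μ.1 e).1) * ((w K).1 - (μ.1 e).1))

/-- Split `w - μ = (w - Πw) + (Πw - μ)`. The first part is at most `w - a` on each face for any
constant `a`; trace and Poincaré inequalities bound it by the gradient, with the powers of `h_K`
cancelling. -/
theorem sum_traceJump_le {k l : ℕ} {Ct Cp : ℝ} (hd : 0 < d) (hCt : 0 < Ct)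
    (htrace : ∀ K : M.cells, ∀ p ∈ PolySpace d k,
      M.size K * ∑ e ∈ M.facesOf K, faceInt e.1 (p * p) ≤ Ct * cellInt K.1 (p * p))
    (w : M.V k) (μ : M.Vhat l)
    (hpoin : ∀ K : M.cells, ∃ a : ℝ, cellInt K.1 (((w K).1 - MvPolynomial.C a) *
      ((w K).1 - MvPolynomial.C a)) ≤ Cp * M.size K ^ 2 * gradSq w K) :
    ∑ K : M.cells, traceJump w μ K ≤
      2 * Ct * Cp * ∑ K : M.cells, gradSq w K + 2 * M.jump w μ w μ := by
  rw [jump, Finset.mul_sum, Finset.mul_sum, ← Finset.sum_add_distrib]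
  refine Finset.sum_le_sum fun K _ => ?_
  obtain ⟨a, ha⟩ := hpoin K
  have hh := size_pos hd K
  have h1 : ∀ e ∈ M.facesOf K, (M.size K)⁻¹ * faceInt e.1
      (((w K).1 - (μ.1 e).1) * ((w K).1 - (μ.1 e).1)) ≤
      2 * (M.size K)⁻¹ * faceInt e.1 (((w K).1 - MvPolynomial.C a) *
        ((w K).1 - MvPolynomial.C a)) +
      2 * ((M.size K)⁻¹ * faceInt e.1 (((M.faceProj l e (w K).1).1 - (μ.1 e).1) *
        ((M.faceProj l e (w K).1).1 - (μ.1 e).1))) := by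
    intro e _
    have h2 := faceProj_error_le (l := l) e (w K).1 a
    set P := (M.faceProj l e (w K).1).1
    have h3 : faceInt e.1 (((w K).1 - (μ.1 e).1) * ((w K).1 - (μ.1 e).1)) ≤
        faceInt e.1 ((2 : ℝ) • (((w K).1 - P) * ((w K).1 - P)) +
          (2 : ℝ) • ((P - (μ.1 e).1) * (P - (μ.1 e).1))) := by
      refine M.faceInt_mono e fun x _ => ?_
      simp only [ev, map_add, map_mul, map_sub, MvPolynomial.smul_eval]
      nlinarith [sq_nonneg (MvPolynomial.eval (fun i => x i) (w K).1 -
        2 * MvPolynomial.eval (fun i => x i) P + MvPolynomial.eval (fun i => x i) (μ.1 e).1)]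
    rw [M.faceInt_eq_functional, M.faceInt_eq_functional, map_add, map_smul, map_smul] at h3
    simp only [smul_eq_mul, ← M.faceInt_eq_functional] at h3
    have h4 := mul_le_mul_of_nonneg_left (h3.trans (add_le_add_left
      (mul_le_mul_of_nonneg_left h2 zero_le_two) _)) (inv_pos.2 hh).le
    linarith
  refine (Finset.sum_le_sum h1).trans ?_
  rw [Finset.sum_add_distrib, ← Finset.mul_sum, ← Finset.mul_sum]
  refine add_le_add_left ?_ _
  have h5 := htrace K _ (Submodule.sub_mem _ (w K).2 (C_mem_polySpace k a))
  have h6 := h5.trans (mul_le_mul_of_nonneg_left ha hCt.le)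
  have h7 : 2 * (M.size K)⁻¹ * ∑ e ∈ M.facesOf K, faceInt e.1
      (((w K).1 - MvPolynomial.C a) * ((w K).1 - MvPolynomial.C a)) =
      2 * ((M.size K) ^ 2)⁻¹ * (M.size K * ∑ e ∈ M.facesOf K, faceInt e.1
      (((w K).1 - MvPolynomial.C a) * ((w K).1 - MvPolynomial.C a))) := by field_simp
  rw [h7]
  refine (mul_le_mul_of_nonneg_left h6 (by positivity)).trans_eq ?_
  field_simp

end PolyMesh

/-! ### The discrete Poincaré inequality. -/

namespace PolyMesh

variable {Ω : Set (Space d)} {M : PolyMesh Ω}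

theorem cell_subset_closure (K : M.cells) : (K : Set (Space d)) ⊆ closure Ω := by
  rw [← M.cell_cover]
  exact subset_closure.trans (Set.subset_biUnion_of_mem (u := fun K => closure K) K.2)

theorem face_subset_closure {K : M.cells} {e : M.faces} (he : e ∈ M.facesOf K) :
    (e : Set (Space d)) ⊆ closure Ω :=
  (M.mem_facesOf.1 he).trans (frontier_subset_closure.trans
    (closure_minimal (cell_subset_closure K) isClosed_closure))

theorem innerV_self_nonneg {k : ℕ} (w : M.V k) : 0 ≤ M.innerV w w :=
  Finset.sum_nonneg fun _ _ => cellInt_nonneg (ev_mul_self_nonneg _)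

/-- With `z = w - m` one has `w² - m² = 2wz - z²`. Young's weight is chosen so that the trace
inequality turns the `w²` term into a quarter of the cell norm; `h ≤ 2R` puts the remaining `z²`
term on the scale `h⁻¹`. -/
theorem face_flux_le {R Ct h t w m : ℝ} (hR : 0 < R) (hCt : 0 < Ct) (hh : 0 < h) (hhR : h ≤ 2 * R)
    (ht : |t| ≤ R) : t * (w * w - m * m) ≤ h / (4 * Ct) * (w * w) +
      (4 * Ct * R ^ 2 + 2 * R ^ 2) * h⁻¹ * ((w - m) * (w - m)) := by
  set z := w - m with hz
  have h1 : t * (w * w - m * m) = t * (2 * w * z - z * z) := by rw [hz]; ring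
  have h2 : t * (2 * w * z - z * z) ≤ R * (2 * (|w| * |z|) + |z| * |z|) := by
    have h3 : |2 * w * z - z * z| ≤ 2 * (|w| * |z|) + |z| * |z| := by
      refine (abs_sub _ _).trans_eq ?_
      rw [abs_mul, abs_mul, abs_mul, abs_two, mul_assoc]
    refine (le_abs_self _).trans ?_
    rw [abs_mul]
    exact mul_le_mul ht h3 (abs_nonneg _) hR.le
  have h4 := mul_le_weighted_sq (a := 2 * R * |z|) (b := |w|) (mul_pos hCt (inv_pos.2 hh))
  have h5 : 1 / (4 * (Ct * h⁻¹)) = h / (4 * Ct) := by field_simp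
  have h6 : R ≤ 2 * R ^ 2 * h⁻¹ := by
    rw [← div_eq_mul_inv, le_div_iff₀ hh]
    nlinarith
  have h7 := mul_le_mul_of_nonneg_right h6 (mul_self_nonneg z)
  have hw := abs_mul_abs_self w
  have hzz := abs_mul_abs_self z
  rw [h5, hw] at h4
  rw [h1]
  have h8 : Ct * h⁻¹ * (2 * R * |z| * (2 * R * |z|)) = 4 * Ct * R ^ 2 * h⁻¹ * (z * z) := by
    rw [← hzz]; ring
  rw [h8] at h4
  rw [hzz] at h2
  linarith

/-- From `w² = ∂_i (x_i w²) - 2 x_i w ∂_i w`, integrated over cells. The volume and the face terms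
each give back a quarter of `‖w‖²`; absorbing these doubles the other constants. -/
theorem innerV_self_le {k l : ℕ} {θ Ct R : ℝ} (hd : 0 < d) (hθ : 0 < θ) (hCt : 0 < Ct) (hR : 0 < R)
    (hΩ : closure Ω ⊆ Metric.closedBall 0 R)
    (hstar : ∀ K : M.cells, ∃ c, M.IsStarCenter θ K c)
    (htrace : ∀ K : M.cells, ∀ p ∈ PolySpace d k,
      M.size K * ∑ e ∈ M.facesOf K, faceInt e.1 (p * p) ≤ Ct * cellInt K.1 (p * p))
    (w : M.V k) (μ : M.Vhat l) :
    M.innerV w w ≤ 8 * R ^ 2 * ∑ K : M.cells, gradSq w K +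
      2 * (4 * Ct * R ^ 2 + 2 * R ^ 2) * ∑ K : M.cells, traceJump w μ K := by
  let i : Fin d := ⟨0, hd⟩
  let X : MvPolynomial (Fin d) ℝ := MvPolynomial.X i
  have hX : ∀ x ∈ closure Ω, |x i| ≤ R := fun x hx =>
    (abs_coord_le_norm x i).trans (by simpa using hΩ hx)
  have hcell : ∀ K : M.cells, cellInt K.1 ((w K).1 * (w K).1) -
      ∑ e ∈ M.facesOf K, M.normal K e i * faceInt e.1 (X * ((μ.1 e).1 * (μ.1 e).1)) ≤
      1 / 2 * cellInt K.1 ((w K).1 * (w K).1) + 4 * R ^ 2 * gradSq w K +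
      (4 * Ct * R ^ 2 + 2 * R ^ 2) * traceJump w μ K := by
    intro K
    obtain ⟨c, hc⟩ := hstar K
    have hh := size_pos hd K
    set p := (w K).1 with hp
    set g := MvPolynomial.pderiv i p with hg
    have hhR : M.size K ≤ 2 * R := cellSize_le (M.cell_polyhedron K K.2).isConnected.nonempty
      ((cell_subset_closure K).trans hΩ)
    have hdiv := cellInt_pderiv K (mul_pos hθ hh) hc.2 i (X * (p * p))
    have h1 : MvPolynomial.pderiv i (X * (p * p)) = p * p + (2 : ℝ) • (X * p * g) := by
      simp only [X, MvPolynomial.pderiv_mul, MvPolynomial.pderiv_X_self, two_smul, hg]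
      ring
    have h2 : - cellInt K.1 ((2 : ℝ) • (X * p * g)) ≤
        1 / 4 * cellInt K.1 (p * p) + 4 * R ^ 2 * gradSq w K := by
      have h3 : cellInt K.1 (-((2 : ℝ) • (X * p * g))) ≤
          cellInt K.1 ((1 / 4 : ℝ) • (p * p) + (4 * R ^ 2) • (g * g)) := by
        refine M.cellInt_mono K fun x hx => ?_
        have h4 : (x i) ^ 2 ≤ R ^ 2 := by
          have := hX x (cell_subset_closure K hx)
          exact sq_le_sq' (neg_le_of_abs_le this) (le_of_abs_le this)
        have h5 := mul_le_mul_of_nonneg_right h4 (sq_nonneg (ev g x))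
        simp only [ev, map_neg, map_add, map_mul, MvPolynomial.smul_eval, X,
          MvPolynomial.eval_X] at h5 ⊢
        nlinarith [sq_nonneg (MvPolynomial.eval (fun i => x i) p / 2 +
          2 * (x i * MvPolynomial.eval (fun i => x i) g))]
      have h6 : cellInt K.1 (g * g) ≤ gradSq w K :=
        Finset.single_le_sum (f := fun i => cellInt K.1
          (MvPolynomial.pderiv i (w K).1 * MvPolynomial.pderiv i (w K).1))
          (fun _ _ => cellInt_nonneg (ev_mul_self_nonneg _)) (Finset.mem_univ i)
      simp only [M.cellInt_eq, map_neg, map_add, map_smul, smul_eq_mul] at h3 h6 ⊢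
      have h7 := mul_le_mul_of_nonneg_left h6 (by positivity : 0 ≤ 4 * R ^ 2)
      linarith
    have h8 : ∑ e ∈ M.facesOf K, M.normal K e i * faceInt e.1 (X * (p * p)) -
        ∑ e ∈ M.facesOf K, M.normal K e i * faceInt e.1 (X * ((μ.1 e).1 * (μ.1 e).1)) ≤
        1 / 4 * cellInt K.1 (p * p) + (4 * Ct * R ^ 2 + 2 * R ^ 2) * traceJump w μ K := by
      have h9 : ∀ e ∈ M.facesOf K, M.normal K e i * faceInt e.1 (X * (p * p)) -
          M.normal K e i * faceInt e.1 (X * ((μ.1 e).1 * (μ.1 e).1)) ≤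
          M.size K / (4 * Ct) * faceInt e.1 (p * p) + (4 * Ct * R ^ 2 + 2 * R ^ 2) *
            ((M.size K)⁻¹ * faceInt e.1 ((p - (μ.1 e).1) * (p - (μ.1 e).1))) := by
        intro e he
        have h10 : faceInt e.1 (M.normal K e i • (X * (p * p) - X * ((μ.1 e).1 * (μ.1 e).1))) ≤
            faceInt e.1 ((M.size K / (4 * Ct)) • (p * p) +
              ((4 * Ct * R ^ 2 + 2 * R ^ 2) * (M.size K)⁻¹) •
                ((p - (μ.1 e).1) * (p - (μ.1 e).1))) := by
          refine M.faceInt_mono e fun x hx => ?_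
          have hn : |M.normal K e i| ≤ 1 :=
            (abs_coord_le_norm _ i).trans_eq (M.norm_normal he)
          have ht : |M.normal K e i * x i| ≤ R := by
            rw [abs_mul]
            have := mul_le_mul hn (hX x (face_subset_closure he hx)) (abs_nonneg _) zero_le_one
            linarith
          have h11 := face_flux_le (w := ev p x) (m := ev (μ.1 e).1 x) hR hCt hh hhR ht
          simp only [ev, map_sub, map_add, map_mul, MvPolynomial.smul_eval, X,
            MvPolynomial.eval_X] at h11 ⊢
          linarith
        simp only [M.faceInt_eq_functional, map_sub, map_add, map_smul, smul_eq_mul] at h10 ⊢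
        linarith
      rw [← Finset.sum_sub_distrib]
      refine (Finset.sum_le_sum h9).trans ?_
      rw [Finset.sum_add_distrib, ← Finset.mul_sum, ← Finset.mul_sum]
      refine add_le_add_left ?_ _
      have h12 := htrace K p (w K).2
      rw [div_mul_eq_mul_div, div_le_iff₀ (by positivity)]
      linarith
    rw [h1] at hdiv
    rw [M.cellInt_eq, map_add, ← M.cellInt_eq, ← M.cellInt_eq] at hdiv
    linarith
  have hsum := Finset.sum_le_sum fun K (_ : K ∈ Finset.univ) => hcell K
  -- The subtracted terms `n_i x_i μ²` contribute nothing in total, so only the differences `w² -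
  -- μ²` count on faces.
  have hzero := M.sum_normal_mul_eq_zero (fun e => faceInt e.1 (X * ((μ.1 e).1 * (μ.1 e).1)))
    (fun e he => by
      refine setIntegral_eq_zero_of_forall_eq_zero fun x hx => ?_
      have h1 := μ.2 e he x hx
      simp only [ev, map_mul] at h1 ⊢
      rw [h1]; ring) i
  rw [Finset.sum_sub_distrib, hzero, Finset.sum_add_distrib, Finset.sum_add_distrib,
    ← Finset.mul_sum, ← Finset.mul_sum, ← Finset.mul_sum] at hsum
  have hV : M.innerV w w = ∑ K : M.cells, cellInt K.1 ((w K).1 * (w K).1) := rfl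
  rw [← hV] at hsum
  linarith

/-- The discrete Poincaré inequality for the energy norm. -/
theorem exists_discrete_poincare (hd : 0 < d) (hΩ : Bornology.IsBounded Ω) {k l : ℕ}
    (hl : k - 1 ≤ l) {θ : ℝ} (hθ : 0 < θ) :
    ∃ C : ℝ, 0 < C ∧ ∀ M : PolyMesh Ω, (∀ K : M.cells, ∃ c, M.IsStarCenter θ K c) →
      ∀ (w : M.V k) (μ : M.Vhat l), M.innerV w w ≤ C * M.energySq w μ := by
  obtain ⟨Ct, hCt, htr⟩ := exists_trace_constant hd k hθ
  obtain ⟨Cp, hCp, hpo⟩ := exists_poincare_constant d k hθ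
  obtain ⟨R, hR0, hR⟩ := hΩ.closure.subset_closedBall_lt 0 0
  set A := 2 * (4 * Ct * R ^ 2 + 2 * R ^ 2) with hA
  set B := 8 * R ^ 2 + A * (2 * Ct * Cp) with hB
  have hA0 : 0 < A := by positivity
  have hB0 : 0 < B := by positivity
  -- The three estimates combine to `‖w‖² ≤ B G + 2 A J` and `G ≤ 2 Q + 2 Ct J`, where `G` is the
  -- broken gradient norm squared and `Q + J` the energy.
  refine ⟨B * (2 + 2 * Ct) + 2 * A, by positivity, fun M hstar w μ => ?_⟩
  have htrace : ∀ K : M.cells, ∀ p ∈ PolySpace d k,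
      M.size K * ∑ e ∈ M.facesOf K, faceInt e.1 (p * p) ≤ Ct * cellInt K.1 (p * p) := fun K p hp =>
    let ⟨c, hc⟩ := hstar K
    htr M K c hc p hp
  have h1 := innerV_self_le hd hθ hCt hR0 hR hstar htrace w μ
  have h2 := sum_traceJump_le (Cp := Cp) hd hCt htrace w μ fun K =>
    let ⟨c, hc⟩ := hstar K
    ⟨_, hpo _ (w K).2 c _ (size_pos hd K) K hc.ball_subset hc.subset_closedBall⟩
  have h3 := sum_gradSq_le hl hθ hd hCt hstar htrace w μ
  have hJ := jump_self_nonneg w μ hd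
  have hQ := innerQ_self_nonneg (M.discreteGrad w μ)
  set G := ∑ K : M.cells, gradSq w K
  set J := M.jump w μ w μ
  set Q := M.innerQ (M.discreteGrad w μ) (M.discreteGrad w μ)
  have h4 : M.energySq w μ = Q + J := rfl
  rw [← hA] at h1
  have h5 : M.innerV w w ≤ B * G + 2 * A * J := by
    have := mul_le_mul_of_nonneg_left h2 hA0.le
    rw [hB]; linarith
  have h6 := mul_le_mul_of_nonneg_left h3 hB0.le
  rw [h4]
  have h7 : 0 ≤ B * Ct * Q := by positivity
  have h8 : 0 ≤ A * Q := by positivity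
  have h9 : 0 ≤ B * J := by positivity
  linarith

end PolyMesh

/-! ### Time-dependent polynomials -/

/-- Evaluation at `x` as a functional on `P_m`. -/
def evFunctional (m : ℕ) (x : Space d) : Module.Dual ℝ (PolySpace d m) :=
  (MvPolynomial.aeval (R := ℝ) (fun i => x i)).toLinearMap.domRestrict _

/-- A polynomial with all values zero is zero, so point evaluations separate `P_m` and, in finite
dimension, span its dual. This transfers regularity in time from the pointwise values of `u_h` to
every linear functional of it. -/
theorem span_evFunctional (m : ℕ) :
    Submodule.span ℝ (Set.range fun x : Space d => evFunctional m x) = ⊤ := by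
  rw [← Subspace.dualCoannihilator_dualAnnihilator_eq
    (W := Submodule.span ℝ (Set.range fun x : Space d => evFunctional m x))]
  have h : (Submodule.span ℝ (Set.range fun x : Space d => evFunctional m x)).dualCoannihilator =
      ⊥ := by
    rw [eq_bot_iff]
    intro p hp
    rw [Submodule.mem_dualCoannihilator] at hp
    refine Subtype.ext (eq_zero_of_ev_eq_zero isOpen_univ Set.univ_nonempty fun x _ => ?_)
    exact hp _ (Submodule.subset_span ⟨x, rfl⟩)
  rw [h, Submodule.dualAnnihilator_bot]

theorem absolutelyContinuousOnInterval_const (c a b : ℝ) :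
    AbsolutelyContinuousOnInterval (fun _ => c) a b :=
  (LipschitzWith.const c).lipschitzOnWith.absolutelyContinuousOnInterval

theorem absolutelyContinuousOnInterval_sum {ι : Type*} (s : Finset ι) {f : ι → ℝ → ℝ} {a b : ℝ}
    (h : ∀ i ∈ s, AbsolutelyContinuousOnInterval (f i) a b) :
    AbsolutelyContinuousOnInterval (fun t => ∑ i ∈ s, f i t) a b := by
  induction s using Finset.induction_on with
  | empty => simpa using absolutelyContinuousOnInterval_const 0 a b
  | insert i s hi ih =>
    simp only [Finset.sum_insert hi]
    exact (h i (Finset.mem_insert_self _ _)).add (ih fun j hj => h j (Finset.mem_insert_of_mem hj))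

theorem absolutelyContinuous_functional {m : ℕ} {v : ℝ → PolySpace d m} {a b : ℝ}
    (hv : ∀ x, AbsolutelyContinuousOnInterval (fun t => ev (v t).1 x) a b)
    (φ : Module.Dual ℝ (PolySpace d m)) :
    AbsolutelyContinuousOnInterval (fun t => φ (v t)) a b := by
  have hφ : φ ∈ Submodule.span ℝ (Set.range fun x : Space d => evFunctional m x) := by
    rw [span_evFunctional]; trivial
  induction hφ using Submodule.span_induction with
  | mem φ h => obtain ⟨x, rfl⟩ := h; exact hv x
  | zero => exact absolutelyContinuousOnInterval_const 0 a b
  | add φ ψ _ _ h1 h2 => exact h1.add h2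
  | smul c φ _ h => exact h.const_mul c

theorem hasDerivAt_functional {m : ℕ} {v : ℝ → PolySpace d m} {v' : PolySpace d m} {t : ℝ}
    (hv : ∀ x, HasDerivAt (fun s => ev (v s).1 x) (ev v'.1 x) t)
    (φ : Module.Dual ℝ (PolySpace d m)) : HasDerivAt (fun s => φ (v s)) (φ v') t := by
  have hφ : φ ∈ Submodule.span ℝ (Set.range fun x : Space d => evFunctional m x) := by
    rw [span_evFunctional]; trivial
  induction hφ using Submodule.span_induction with
  | mem φ h => obtain ⟨x, rfl⟩ := h; exact hv x
  | zero => exact hasDerivAt_const t 0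
  | add φ ψ _ _ h1 h2 => exact h1.add h2
  | smul c φ _ h => exact h.const_mul c

/-- It writes a quadratic expression as a finite sum of products of linear functionals, to which the
product rules for absolute continuity and derivatives apply. -/
theorem bilin_eq_sum {V : Type*} [AddCommGroup V] [Module ℝ V] [FiniteDimensional ℝ V]
    (B : V →ₗ[ℝ] V →ₗ[ℝ] ℝ) (v w : V) :
    B v w = ∑ j, (Module.finBasis ℝ V).coord j w * B.flip (Module.finBasis ℝ V j) v := by
  conv_lhs => rw [← (Module.finBasis ℝ V).sum_repr w, map_sum]
  exact Finset.sum_congr rfl fun j _ => by rw [map_smul]; rfl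

theorem absolutelyContinuous_bilin {m : ℕ} {v : ℝ → PolySpace d m} {a b : ℝ}
    (hv : ∀ x, AbsolutelyContinuousOnInterval (fun t => ev (v t).1 x) a b)
    (B : PolySpace d m →ₗ[ℝ] PolySpace d m →ₗ[ℝ] ℝ) :
    AbsolutelyContinuousOnInterval (fun t => B (v t) (v t)) a b := by
  simp only [bilin_eq_sum B]
  exact absolutelyContinuousOnInterval_sum _ fun j _ =>
    (absolutelyContinuous_functional hv _).fun_mul (absolutelyContinuous_functional hv _)

theorem hasDerivAt_bilin {m : ℕ} {v : ℝ → PolySpace d m} {v' : PolySpace d m} {t : ℝ}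
    (hv : ∀ x, HasDerivAt (fun s => ev (v s).1 x) (ev v'.1 x) t)
    (B : PolySpace d m →ₗ[ℝ] PolySpace d m →ₗ[ℝ] ℝ) :
    HasDerivAt (fun s => B (v s) (v s)) (B (v t) v' + B v' (v t)) t := by
  simp only [bilin_eq_sum B]
  rw [← Finset.sum_add_distrib]
  exact HasDerivAt.fun_sum fun j _ =>
    (hasDerivAt_functional hv _).fun_mul (hasDerivAt_functional hv _)

namespace PolyMesh

variable {Ω : Set (Space d)} {M : PolyMesh Ω}

/-- `(p, q) ↦ ∫_K p q` on `P_k`. -/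
def cellForm (M : PolyMesh Ω) (k : ℕ) (K : M.cells) :
    PolySpace d k →ₗ[ℝ] PolySpace d k →ₗ[ℝ] ℝ :=
  (mulForm (M.cellFunctional K) LinearMap.id).domRestrict₁₂ _ _

theorem innerV_eq {k : ℕ} (u v : M.V k) :
    M.innerV u v = ∑ K : M.cells, M.cellForm k K (u K) (v K) := rfl

theorem innerV_comm {k : ℕ} (u v : M.V k) : M.innerV u v = M.innerV v u :=
  Finset.sum_congr rfl fun K _ => by rw [mul_comm]

theorem absolutelyContinuous_innerV {k : ℕ} {u : ℝ → M.V k} {a b : ℝ}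
    (hu : ∀ (K : M.cells) (x : Space d),
      AbsolutelyContinuousOnInterval (fun t => ev (u t K).1 x) a b) :
    AbsolutelyContinuousOnInterval (fun t => M.innerV (u t) (u t)) a b := by
  simp only [innerV_eq]
  exact absolutelyContinuousOnInterval_sum _ fun K _ => absolutelyContinuous_bilin (hu K) _

theorem hasDerivAt_innerV {k : ℕ} {u : ℝ → M.V k} {u' : M.V k} {t : ℝ}
    (hu : ∀ (K : M.cells) (x : Space d),
      HasDerivAt (fun s => ev (u s K).1 x) (ev (u' K).1 x) t) :
    HasDerivAt (fun s => M.innerV (u s) (u s)) (2 * M.innerV u' (u t)) t := by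
  have h : 2 * M.innerV u' (u t) = ∑ K : M.cells,
      (M.cellForm k K (u t K) (u' K) + M.cellForm k K (u' K) (u t K)) := by
    rw [Finset.sum_add_distrib, ← innerV_eq, ← innerV_eq, innerV_comm (u t), two_mul]
  rw [h]
  simp only [innerV_eq]
  exact HasDerivAt.fun_sum fun K _ => hasDerivAt_bilin (hu K) _

/-! ### The load -/

theorem cell_subset (hΩ : IsOpenPolyhedron Ω) (K : M.cells) : (K : Set (Space d)) ⊆ Ω := by
  have h := interior_maximal (cell_subset_closure K) (M.cell_polyhedron K K.2).isOpen
  exact h.trans_eq hΩ.regular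

theorem restrict_restrict_cell (hΩ : IsOpenPolyhedron Ω) (K : M.cells) :
    ((volume : Measure (Space d)).restrict Ω).restrict (K : Set (Space d)) =
      volume.restrict (K : Set (Space d)) :=
  Measure.restrict_restrict_of_subset (cell_subset hΩ K)

theorem memLp_ev (K : M.cells) (p : MvPolynomial (Fin d) ℝ) :
    MemLp (ev p) 2 ((volume : Measure (Space d)).restrict (K : Set (Space d))) := by
  rw [memLp_two_iff_integrable_sq (continuous_ev p).aestronglyMeasurable]
  have h := M.integrableOn_cell K (p * p)
  refine h.congr (Eventually.of_forall fun x => ?_)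
  simp [ev, sq]

theorem memLp_load (hΩ : IsOpenPolyhedron Ω) (K : M.cells)
    (f : Lp ℝ 2 ((volume : Measure (Space d)).restrict Ω)) :
    MemLp f 2 ((volume : Measure (Space d)).restrict (K : Set (Space d))) :=
  (Lp.memLp f).mono_measure (Measure.restrict_mono (cell_subset hΩ K) le_rfl)

theorem integrable_load_mul (hΩ : IsOpenPolyhedron Ω) (K : M.cells)
    (f : Lp ℝ 2 ((volume : Measure (Space d)).restrict Ω)) (p : MvPolynomial (Fin d) ℝ) :
    IntegrableOn (fun x => f x * ev p x) (K : Set (Space d)) volume :=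
  (memLp_load hΩ K f).integrable_mul (memLp_ev K p)

/-- `p ↦ ∫_K f p` as a linear functional. -/
def loadFunctional (hΩ : IsOpenPolyhedron Ω) (k : ℕ) (K : M.cells)
    (f : Lp ℝ 2 ((volume : Measure (Space d)).restrict Ω)) : PolySpace d k →ₗ[ℝ] ℝ where
  toFun p := ∫ x in (K : Set (Space d)), f x * ev p.1 x
  map_add' p q := by
    rw [← integral_add (integrable_load_mul hΩ K f p) (integrable_load_mul hΩ K f q)]
    refine integral_congr_ae (Eventually.of_forall fun x => ?_)
    simp [ev, mul_add]
  map_smul' c p := by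
    rw [RingHom.id_apply, smul_eq_mul, ← integral_const_mul]
    refine integral_congr_ae (Eventually.of_forall fun x => ?_)
    simp [ev]; ring

theorem load_eq (hΩ : IsOpenPolyhedron Ω) {k : ℕ}
    (f : Lp ℝ 2 ((volume : Measure (Space d)).restrict Ω)) (w : M.V k) :
    M.load f w = ∑ K : M.cells, loadFunctional hΩ k K f (w K) := rfl

/-- Restriction of square-integrable functions on `Ω` to a cell. -/
def restrictCell (K : M.cells) : Lp ℝ 2 ((volume : Measure (Space d)).restrict Ω) →L[ℝ]
    Lp ℝ 2 (((volume : Measure (Space d)).restrict Ω).restrict (K : Set (Space d))) :=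
  LpToLpRestrictCLM (Space d) ℝ ℝ ((volume : Measure (Space d)).restrict Ω) 2 (K : Set (Space d))

theorem setIntegral_sq_eq (hΩ : IsOpenPolyhedron Ω) (K : M.cells)
    (f : Lp ℝ 2 ((volume : Measure (Space d)).restrict Ω)) :
    ∫ x in (K : Set (Space d)), f x ^ 2 = ‖restrictCell K f‖ ^ 2 := by
  rw [← real_inner_self_eq_norm_sq, L2.inner_def, ← restrict_restrict_cell hΩ K]
  refine integral_congr_ae ?_
  filter_upwards [LpToLpRestrictCLM_coeFn ℝ (K : Set (Space d)) f] with x hx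
  have hx' : restrictCell K f x = f x := hx
  rw [hx']; simp [sq]

/-- It is the `L²` inner product with a fixed function after restriction to the cell. Continuity in
`f` is what yields measurability of the load in time. -/
theorem continuous_loadFunctional (hΩ : IsOpenPolyhedron Ω) {k : ℕ} (K : M.cells)
    (p : PolySpace d k) : Continuous fun f => loadFunctional hΩ k K f p := by
  have hmem : MemLp (ev p.1) 2
      (((volume : Measure (Space d)).restrict Ω).restrict (K : Set (Space d))) := by
    rw [restrict_restrict_cell hΩ K]
    exact memLp_ev K p.1
  have h : ∀ f, loadFunctional hΩ k K f p = inner ℝ (hmem.toLp _) (restrictCell K f) := by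
    intro f
    rw [L2.inner_def]
    change ∫ x in (K : Set (Space d)), f x * ev p.1 x = _
    rw [← restrict_restrict_cell hΩ K]
    refine integral_congr_ae ?_
    filter_upwards [LpToLpRestrictCLM_coeFn ℝ (K : Set (Space d)) f, hmem.coeFn_toLp] with x hx hp
    have hx' : restrictCell K f x = f x := hx
    rw [hx', hp]; simp
  simp only [h]
  exact continuous_const.inner (restrictCell K).continuous

theorem loadNormSq_nonneg (f : Lp ℝ 2 ((volume : Measure (Space d)).restrict Ω)) :
    0 ≤ M.loadNormSq f :=
  Finset.sum_nonneg fun _ _ => integral_nonneg fun _ => sq_nonneg _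

theorem abs_load_le (hΩ : IsOpenPolyhedron Ω) {k : ℕ}
    (f : Lp ℝ 2 ((volume : Measure (Space d)).restrict Ω)) (w : M.V k) {a : ℝ} (ha : 0 < a) :
    2 * |M.load f w| ≤ a * M.loadNormSq f + a⁻¹ * M.innerV w w := by
  have h1 : ∀ K : M.cells, 2 * |∫ x in (K : Set (Space d)), f x * ev (w K).1 x| ≤
      a * (∫ x in (K : Set (Space d)), f x ^ 2) + a⁻¹ * cellInt K.1 ((w K).1 * (w K).1) := by
    intro K
    have hf := (memLp_load hΩ K f).integrable_sq
    have hw := M.integrableOn_cell K ((w K).1 * (w K).1)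
    have h2 : ∫ x in (K : Set (Space d)), 2 * |f x * ev (w K).1 x| ≤
        ∫ x in (K : Set (Space d)), (a * f x ^ 2 + a⁻¹ * ev ((w K).1 * (w K).1) x) := by
      refine integral_mono ((integrable_load_mul hΩ K f _).abs.const_mul 2)
        ((hf.const_mul a).add (hw.const_mul a⁻¹)) fun x => ?_
      have h3 : ev ((w K).1 * (w K).1) x = ev (w K).1 x * ev (w K).1 x := by simp [ev]
      simp only [h3, abs_mul]
      have h4 := mul_le_weighted_sq (a := 2 * |f x|) (b := |ev (w K).1 x|)
        (lam := a / 4) (by positivity)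
      have h5 := abs_mul_abs_self (f x)
      rw [abs_mul_abs_self] at h4
      have h6 : 1 / (4 * (a / 4)) = a⁻¹ := by field_simp
      have h7 : a / 4 * (2 * |f x| * (2 * |f x|)) = a * f x ^ 2 := by rw [sq, ← h5]; ring
      rw [h6, h7] at h4
      linarith
    rw [integral_const_mul, integral_add (hf.const_mul a) (hw.const_mul a⁻¹), integral_const_mul,
      integral_const_mul] at h2
    exact (mul_le_mul_of_nonneg_left (abs_integral_le_integral_abs) zero_le_two).trans h2
  rw [load, loadNormSq, innerV, Finset.mul_sum, Finset.mul_sum, ← Finset.sum_add_distrib]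
  refine (mul_le_mul_of_nonneg_left (Finset.abs_sum_le_sum_abs _ _) zero_le_two).trans ?_
  rw [Finset.mul_sum]
  exact Finset.sum_le_sum fun K _ => h1 K

/-! ### The energy identity -/

/-- The antisymmetric splitting of the convection form makes this pure algebra: no integration by
parts and no continuity across faces are involved. -/
theorem conv_self {k l : ℕ} (u : M.V k) (û : M.Vhat l) : M.conv u u û u û = 0 := by
  have h1 : ∀ (K : M.cells) i, (u K).1 * MvPolynomial.pderiv i (u K).1 * (u K).1 =
      (u K).1 * (u K).1 * MvPolynomial.pderiv i (u K).1 := fun K i => by ring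
  have h2 : ∀ (K : M.cells) (e : M.faces), (u K).1 * (û.1 e).1 * (u K).1 =
      (u K).1 * (u K).1 * (û.1 e).1 := fun K e => by ring
  simp only [conv, h1, h2]
  ring

theorem IsSemiDiscreteSolution.energy_identity {k l : ℕ} {ν T : ℝ}
    {f : ℝ → Lp ℝ 2 ((volume : Measure (Space d)).restrict Ω)}
    {u₀ : Lp ℝ 2 ((volume : Measure (Space d)).restrict Ω)}
    {q : ℝ → M.Q k} {u : ℝ → M.V k} {û : ℝ → M.Vhat l}
    (h : M.IsSemiDiscreteSolution ν T f u₀ q u û) :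
    ∀ᵐ t ∂((volume : Measure ℝ).restrict (Set.Ioo 0 T)),
      deriv (fun s => M.innerV (u s) (u s)) t / 2 + ν * M.energySq (u t) (û t) =
        M.load (f t) (u t) := by
  filter_upwards [h.scheme] with t ht
  obtain ⟨-, ut, hut, heq⟩ := ht
  rw [(hasDerivAt_innerV hut).deriv, ← heq (u t) (û t), conv_self, stab, energySq]
  ring

theorem integrable_loadNormSq (hΩ : IsOpenPolyhedron Ω) {T : ℝ}
    {f : ℝ → Lp ℝ 2 ((volume : Measure (Space d)).restrict Ω)}
    (hf : MemLp f 2 ((volume : Measure ℝ).restrict (Set.Ioo 0 T))) :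
    IntegrableOn (fun s => M.loadNormSq (f s)) (Set.Ioo 0 T) := by
  simp only [loadNormSq, setIntegral_sq_eq hΩ]
  refine integrable_finsetSum _ fun K _ => ?_
  exact ((restrictCell K).comp_memLp' hf).norm.integrable_sq

theorem integrable_load (hΩ : IsOpenPolyhedron Ω) {k : ℕ} {T : ℝ}
    {f : ℝ → Lp ℝ 2 ((volume : Measure (Space d)).restrict Ω)}
    (hf : MemLp f 2 ((volume : Measure ℝ).restrict (Set.Ioo 0 T))) {u : ℝ → M.V k} (hT : 0 ≤ T)
    (hu : ∀ (K : M.cells) (x : Space d),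
      AbsolutelyContinuousOnInterval (fun t => ev (u t K).1 x) 0 T) :
    IntegrableOn (fun s => M.load (f s) (u s)) (Set.Ioo 0 T) := by
  have hN : IntegrableOn (fun s => M.innerV (u s) (u s)) (Set.Ioo 0 T) := by
    have := (absolutelyContinuous_innerV hu).continuousOn
    rw [Set.uIcc_of_le hT] at this
    exact this.integrableOn_Icc.mono_set Set.Ioo_subset_Icc_self
  refine Integrable.mono' ((integrable_loadNormSq (M := M) hΩ hf).add hN) ?_
    (Eventually.of_forall fun s => ?_)
  · simp only [load_eq hΩ]
    refine Finset.aestronglyMeasurable_fun_sum _ fun K _ => ?_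
    -- Expanding `u_h(s)` in a fixed basis separates the two time dependences: the coordinates are
    -- continuous in `s`, and the other factors are continuous functions of `f s`.
    have h1 : ∀ s, loadFunctional hΩ k K (f s) (u s K) =
        ∑ j, (Module.finBasis ℝ (PolySpace d k)).coord j (u s K) *
          loadFunctional hΩ k K (f s) (Module.finBasis ℝ (PolySpace d k) j) := fun s => by
      conv_lhs => rw [← (Module.finBasis ℝ (PolySpace d k)).sum_repr (u s K), map_sum]
      exact Finset.sum_congr rfl fun j _ => by rw [map_smul]; rfl
    simp only [h1]
    refine Finset.aestronglyMeasurable_fun_sum _ fun j _ => ?_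
    refine AEStronglyMeasurable.mul ?_
      ((continuous_loadFunctional hΩ K _).comp_aestronglyMeasurable hf.1)
    have := (absolutelyContinuous_functional (hu K)
      ((Module.finBasis ℝ (PolySpace d k)).coord j)).continuousOn
    rw [Set.uIcc_of_le hT] at this
    exact (this.mono Set.Ioo_subset_Icc_self).aestronglyMeasurable measurableSet_Ioo
  · have h1 := abs_load_le hΩ (f s) (u s) one_pos
    have h2 := abs_nonneg (M.load (f s) (u s))
    rw [inv_one, one_mul, one_mul] at h1
    rw [Real.norm_eq_abs, Pi.add_apply]
    linarith

theorem ShapeRegular.exists_isStarCenter {θ ℓ : ℝ} (h : M.ShapeRegular θ ℓ) (K : M.cells) :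
    ∃ c, M.IsStarCenter θ K c :=
  h.star K K.2

/-- Integrate the energy identity in time, using the fundamental theorem for the absolutely
continuous function `‖u_h‖²`, and absorb half of the dissipation. -/
theorem IsSemiDiscreteSolution.stability (hΩ : IsOpenPolyhedron Ω) {k l : ℕ} {ν T C : ℝ}
    (hν : 0 < ν) (hC : 0 < C)
    (hpoin : ∀ (w : M.V k) (μ : M.Vhat l), M.innerV w w ≤ C * M.energySq w μ)
    {f : ℝ → Lp ℝ 2 ((volume : Measure (Space d)).restrict Ω)}
    (hf : MemLp f 2 ((volume : Measure ℝ).restrict (Set.Ioo 0 T)))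
    {u₀ : Lp ℝ 2 ((volume : Measure (Space d)).restrict Ω)}
    {q : ℝ → M.Q k} {u : ℝ → M.V k} {û : ℝ → M.Vhat l}
    (h : M.IsSemiDiscreteSolution ν T f u₀ q u û) {t : ℝ} (ht : t ∈ Set.Icc 0 T) :
    IntervalIntegrable (fun s => M.energySq (u s) (û s)) volume 0 t ∧
      M.innerV (u t) (u t) + ν * ∫ s in (0 : ℝ)..t, M.energySq (u s) (û s) ≤
        M.innerV (u 0) (u 0) + C / ν * ∫ s in (0 : ℝ)..t, M.loadNormSq (f s) := by
  have hT : 0 ≤ T := ht.1.trans ht.2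
  have hsub : Set.Ioo 0 t ⊆ Set.Ioo 0 T := Set.Ioo_subset_Ioo_right ht.2
  set N := fun s => M.innerV (u s) (u s) with hN
  have hAC : AbsolutelyContinuousOnInterval N 0 t := by
    refine (absolutelyContinuous_innerV h.absCont).mono ?_
    rw [Set.uIcc_of_le ht.1, Set.uIcc_of_le hT]
    exact Set.Icc_subset_Icc_right ht.2
  have hderiv := hAC.intervalIntegrable_deriv
  have hload : IntervalIntegrable (fun s => M.load (f s) (u s)) volume 0 t :=
    (intervalIntegrable_iff_integrableOn_Ioo_of_le ht.1).2
      ((integrable_load hΩ hf hT h.absCont).mono_set hsub)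
  have hF : IntervalIntegrable (fun s => M.loadNormSq (f s)) volume 0 t :=
    (intervalIntegrable_iff_integrableOn_Ioo_of_le ht.1).2
      ((integrable_loadNormSq hΩ hf).mono_set hsub)
  have hid : ∀ᵐ s ∂((volume : Measure ℝ).restrict (Set.Ioc 0 t)),
      M.energySq (u s) (û s) = ν⁻¹ * (M.load (f s) (u s) - deriv N s / 2) := by
    rw [← Measure.restrict_congr_set Ioo_ae_eq_Ioc]
    filter_upwards [ae_restrict_of_ae_restrict_of_subset hsub h.energy_identity] with s hs
    rw [← hs]
    field_simp
    ring
  -- No measurability in time is assumed of `û`. Integrability of the energy is read off from the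
  -- identity, which expresses it almost everywhere through the load and the derivative of `‖u_h‖²`.
  have hE : IntervalIntegrable (fun s => M.energySq (u s) (û s)) volume 0 t := by
    refine ((hload.sub (hderiv.div_const 2)).const_mul ν⁻¹).congr_ae ?_
    rw [Set.uIoc_of_le ht.1]
    filter_upwards [hid] with s hs using hs.symm
  refine ⟨hE, ?_⟩
  have hint : ν * ∫ s in (0 : ℝ)..t, M.energySq (u s) (û s) =
      (∫ s in (0 : ℝ)..t, M.load (f s) (u s)) - (N t - N 0) / 2 := by
    have h1 : ∫ s in (0 : ℝ)..t, M.energySq (u s) (û s) =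
        ∫ s in (0 : ℝ)..t, ν⁻¹ * (M.load (f s) (u s) - deriv N s / 2) := by
      refine intervalIntegral.integral_congr_ae_restrict ?_
      rw [Set.uIoc_of_le ht.1]
      exact hid
    rw [h1, intervalIntegral.integral_const_mul, mul_inv_cancel_left₀ hν.ne',
      intervalIntegral.integral_sub hload (hderiv.div_const 2), intervalIntegral.integral_div,
      hAC.integral_deriv_eq_sub]
  have hbound : ∫ s in (0 : ℝ)..t, M.load (f s) (u s) ≤
      ∫ s in (0 : ℝ)..t, (C / (2 * ν) * M.loadNormSq (f s) +
        ν / 2 * M.energySq (u s) (û s)) := by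
    refine intervalIntegral.integral_mono_on ht.1 hload
      ((hF.const_mul _).add (hE.const_mul _)) fun s _ => ?_
    -- The weight `C / ν` leaves `ν / C` on `‖u_h‖²`, which the Poincaré inequality turns into `ν`
    -- times the energy; halved, this can be absorbed on the left.
    have h1 := abs_load_le hΩ (f s) (u s) (div_pos hC hν)
    have h2 := mul_le_mul_of_nonneg_left (hpoin (u s) (û s)) (div_pos hν hC).le
    have h3 : ν / C * (C * M.energySq (u s) (û s)) = ν * M.energySq (u s) (û s) := by field_simp
    have h4 : C / (2 * ν) * M.loadNormSq (f s) = C / ν * M.loadNormSq (f s) / 2 := by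
      field_simp
    rw [inv_div] at h1
    have h5 := le_abs_self (M.load (f s) (u s))
    rw [h4]
    linarith
  rw [intervalIntegral.integral_add (hF.const_mul _) (hE.const_mul _),
    intervalIntegral.integral_const_mul, intervalIntegral.integral_const_mul] at hbound
  have h6 : C / (2 * ν) * ∫ s in (0 : ℝ)..t, M.loadNormSq (f s) =
      C / ν * (∫ s in (0 : ℝ)..t, M.loadNormSq (f s)) / 2 := by field_simp
  rw [h6] at hbound
  change N t + _ ≤ N 0 + _
  linarith

end PolyMesh

end HDG

end

/-! ### The stability estimate. -/

theorem mainTheorem5 {d : ℕ} (hd : d = 2 ∨ d = 3) {Ω : Set (HDG.Space d)}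
    (hΩ : HDG.IsOpenPolyhedron Ω) (k l : ℕ) (hk : 1 ≤ k) (hl : l = k ∨ l = k - 1)
    (θ ℓ : ℝ) (hθ : 0 < θ) (hℓ : 0 < ℓ) :
    ∃ C : ℝ, 0 < C ∧ ∀ M : HDG.PolyMesh Ω, M.ShapeRegular θ ℓ →
      ∀ (ν T : ℝ), 0 < ν → 0 < T →
      ∀ (u₀ : Lp ℝ 2 ((volume : Measure (HDG.Space d)).restrict Ω))
        (f : ℝ → Lp ℝ 2 ((volume : Measure (HDG.Space d)).restrict Ω)),
      MemLp f 2 ((volume : Measure ℝ).restrict (Set.Ioo 0 T)) →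
      ∀ (q : ℝ → M.Q k) (u : ℝ → M.V k) (û : ℝ → M.Vhat l),
      M.IsSemiDiscreteSolution ν T f u₀ q u û →
      ∀ t ∈ Set.Icc 0 T,
        IntervalIntegrable (fun s => M.energySq (u s) (û s)) volume 0 t ∧
        M.innerV (u t) (u t) + ν * ∫ s in (0 : ℝ)..t, M.energySq (u s) (û s)
          ≤ C * (M.innerV (u 0) (u 0) + 1 / ν * ∫ s in (0 : ℝ)..t, M.loadNormSq (f s)) := by
  have hd0 : 0 < d := by omega
  have hb : Bornology.IsBounded Ω := hΩ.polyhedral.isCompact.isBounded.subset subset_closure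
  obtain ⟨C, hC, hpoin⟩ := HDG.PolyMesh.exists_discrete_poincare hd0 hb
    (k := k) (l := l) (by omega) hθ
  -- `1 + C` dominates both the coefficient `1` of the initial datum and the coefficient `C` of the
  -- load.
  refine ⟨1 + C, by positivity, fun M hM ν T hν _ u₀ f hf q u û h t ht => ?_⟩
  obtain ⟨hE, hle⟩ := h.stability hΩ hν hC (hpoin M hM.exists_isStarCenter) hf ht
  refine ⟨hE, hle.trans ?_⟩
  have hF : 0 ≤ ∫ s in (0 : ℝ)..t, M.loadNormSq (f s) :=
    intervalIntegral.integral_nonneg ht.1 fun s _ => HDG.PolyMesh.loadNormSq_nonneg (f s)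
  have h1 : C / ν * ∫ s in (0 : ℝ)..t, M.loadNormSq (f s) =
      C * (1 / ν * ∫ s in (0 : ℝ)..t, M.loadNormSq (f s)) := by field_simp
  have h2 : 0 ≤ 1 / ν * ∫ s in (0 : ℝ)..t, M.loadNormSq (f s) := by positivity
  have h3 := mul_nonneg hC.le (HDG.PolyMesh.innerV_self_nonneg (u 0))
  rw [h1]
  linarith
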